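/- Let $d\ge 1$ be an integer and $\alpha>d/2$ a real number. For a sequence $x_1,x_2,\dots$ of points of $(0,1)^d$ and an integer $n\ge 0$ let $$\mathcal O^{d,\alpha}(x_1,\dots,x_n)=\sum_{i=2}^n d(x_i;\{x_1,\dots,x_{i-1}\})^\alpha ,\qquad d(x;S)=\inf_{y\in S\setminus\{x\}}\|x-y\|$$ (Euclidean norm), with the value $0$ for $n\le 1$; this is the total $\alpha$-power-weighted edge length of the on-line nearest-neighbour graph, in which each point after the first is joined to its nearest predecessor. Let $U_1,U_2,\dots$ be independent uniform random vectors in $(0,1)^d$ and $\mathcal U_n=(U_1,\dots,U_n)$, let $(N(t))_{t\ge0}$ be the counting process of a homogeneous Poisson process of unit rate on $(0,\infty)$, defined on the same probability space and independent of $(U_1,U_2,\dots)$, and put $\mathcal P_t=\mathcal U_{N(t)}$ for $t\geq 0$. Write $\tilde{\mathcal O}^{d,\alpha}(\cdot)=\mathcal O^{d,\alpha}(\cdot)-\mathbb E[\mathcal O^{d,\alpha}(\cdot)]$ for the centred functionals. Then there is a mean-zero random variable $Q(d,\alpha)$ in $L^2$, whose law depends only on $d$ and $\alpha$, and which is non-Gaussian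 if $\alpha>d$ (its law is then not normal, nor a point mass), such that (i) $\tilde{\mathcal O}^{d,\alpha}(\mathcal U_n)\to Q(d,\alpha)$ in $L^2$ as $n\to\infty$; (ii) $\tilde{\mathcal O}^{d,\alpha}(\mathcal P_t)\to Q(d,\alpha)$ in $L^2$ as $t\to\infty$ (through the reals, in particular through the integers), with the same random variable $Q(d,\alpha)$ as in (i). -/

import Mathlib

open MeasureTheory ProbabilityTheory Filter Topology
open scoped NNReal ENNReal

noncomputable section

namespace ONG

/-- The open unit cube `(0,1)^d` in Euclidean space. -/
def unitCube (d : ℕ) : Set (EuclideanSpace ℝ (Fin d)) :=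
  {x | ∀ k, x k ∈ Set.Ioo (0 : ℝ) 1}

/-- `d(x; S) = inf_{y ∈ S \ {x}} ‖x - y‖`, the distance from `x` to its nearest neighbour
in `S \ {x}`. -/
def nnDist {d : ℕ} (x : EuclideanSpace ℝ (Fin d)) (S : Set (EuclideanSpace ℝ (Fin d))) : ℝ :=
  Metric.infDist x (S \ {x})

/-- Total power-weighted edge length of the on-line nearest-neighbour graph on the first `n`
points of the sequence `x 0, x 1, x 2, …`: each point after the first contributes the `α`-th power
of the distance to its nearest neighbour among the points that precede it.  (The points are
indexed from `0`; the value is `0` for `n = 0` and for `n = 1`.) -/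
def ongLength {d : ℕ} (α : ℝ) (x : ℕ → EuclideanSpace ℝ (Fin d)) (n : ℕ) : ℝ :=
  ∑ i ∈ Finset.Ico 1 n, nnDist (x i) (x '' Set.Iio i) ^ α

/-- A real random variable minus its expectation. -/
def centred {Ω : Type*} [MeasurableSpace Ω] (P : Measure Ω) (X : Ω → ℝ) : Ω → ℝ :=
  fun ω => X ω - ∫ ω', X ω' ∂P

/-- `X i → Y` in `L²(P)` along the filter `l`; all the variables are required to lie in `L²`. -/
def TendstoInL2 {Ω ι : Type*} [MeasurableSpace Ω] (P : Measure Ω)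
    (X : ι → Ω → ℝ) (l : Filter ι) (Y : Ω → ℝ) : Prop :=
  (∀ i, MemLp (X i) 2 P) ∧ MemLp Y 2 P ∧
    Tendsto (fun i => eLpNorm (X i - Y) 2 P) l (𝓝 0)

/-- `U 0, U 1, …` are independent random vectors, each uniformly distributed on `(0,1)^d`. -/
structure IsIIDUniform {Ω : Type*} [MeasurableSpace Ω] (P : Measure Ω) {d : ℕ}
    (U : ℕ → Ω → EuclideanSpace ℝ (Fin d)) : Prop where
  measurable : ∀ i, Measurable (U i)
  indep : iIndepFun U P
  uniform : ∀ i, pdf.IsUniform (U i) (unitCube d) P volume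

/-- `N` is the counting process of a homogeneous Poisson process of unit rate on `(0,∞)`:
it starts from `0`, its paths are almost surely nondecreasing and right-continuous, and it has
independent increments, the one over `(s,t]` being Poisson distributed with mean `t - s`. -/
structure IsUnitPoissonProcess {Ω : Type*} [MeasurableSpace Ω] (P : Measure Ω)
    (N : ℝ≥0 → Ω → ℕ) : Prop where
  measurable : ∀ t, Measurable (N t)
  zero : ∀ᵐ ω ∂P, N 0 ω = 0
  mono : ∀ᵐ ω ∂P, Monotone (fun t => N t ω)
  rightCts : ∀ᵐ ω ∂P, ∀ t, ContinuousWithinAt (fun s => N s ω) (Set.Ici t) t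
  indepIncr : HasIndepIncrements N P
  poissonIncr : ∀ s t, s ≤ t → P.map (fun ω => N t ω - N s ω) = poissonMeasure (t - s)

end ONG

end

/-! Write Z_n for the weight of the edge from the point of index n + 1 (`edgeWeight`) and W_n for
its mean given the predecessors (`condWeight`). Split Z_n − E Z_n = (Z_n − W_n) + (W_n − E W_n);
both series converge in L², for different reasons.

A ball of radius r ≤ √d about a point of the cube has mass at least (r/√d)^d, so the distance to the
nearest of n + 1 uniform points has β-th moment O(n^(−β/d)) (`exists_lintegral_minDist_rpow_le`).
The Z_n − W_n are martingale differences, hence orthogonal, with squared norms at most E Z_n² =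
O(n^(−2α/d)), which is summable because α > d/2.

The W_n − E W_n are not orthogonal but are much smaller. The variance of W_n is the integral over
pairs (u, v) of the covariance of the weights at u and v. Emptiness of two disjoint balls is
negatively correlated, so only pairs whose empty balls meet contribute. Then u and v are within
twice the larger radius r of each other, which costs a volume of order r^d; the variance is of the
order of the moment of exponent 2α + d, namely O(n^(−1−2α/d)) (`exists_variance_condWeight_le`). The
norms are therefore absolutely summable, and `exists_tendsto_centredWeight` follows.

The limit is built once, as a function Q on the space of sequences, so its law depends on d and α
only and one variable serves both limits. For the Poisson version, independence lets the L² error of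
the centred sums be averaged over N(t). What remains is the variance of the mean function at N(t):
its increments are O(k^(−γ)) with γ > 1/2, while N(t) fluctuates by about √t, so the variance is
O(t^(1−2γ)).

If α > d the means of the Z_n are summable, so Q is bounded below, which no nondegenerate Gaussian
is. A point mass is excluded by exchanging the first and third points: this preserves the law but
shifts the centred sums by an amount that is nonzero with positive probability. -/

noncomputable section

namespace ONG

/-! ### Uniform measure on the cube and the masses of balls -/

section UniformLaw

/-- The uniform distribution on the unit cube. -/
def cubeLaw (d : ℕ) : Measure (EuclideanSpace ℝ (Fin d)) :=
  ProbabilityTheory.cond volume (unitCube d)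

variable {d : ℕ}

lemma unitCube_eq_preimage :
    unitCube d = WithLp.ofLp ⁻¹' (Set.univ.pi fun _ : Fin d => Set.Ioo (0 : ℝ) 1) := by
  ext x
  simp [unitCube, -Set.mem_Ioo]

lemma isOpen_unitCube : IsOpen (unitCube d) := by
  rw [unitCube_eq_preimage]
  exact (isOpen_set_pi Set.finite_univ fun _ _ => isOpen_Ioo).preimage
    (PiLp.continuous_ofLp 2 _)

lemma volume_box (a b : Fin d → ℝ) :
    volume {x : EuclideanSpace ℝ (Fin d) | ∀ k, x k ∈ Set.Ioo (a k) (b k)} =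
      ∏ k, ENNReal.ofReal (b k - a k) := by
  have h : {x : EuclideanSpace ℝ (Fin d) | ∀ k, x k ∈ Set.Ioo (a k) (b k)} =
      WithLp.ofLp ⁻¹' (Set.univ.pi fun k : Fin d => Set.Ioo (a k) (b k)) := by
    ext x
    simp [-Set.mem_Ioo]
  rw [h, (PiLp.volume_preserving_ofLp (Fin d)).measure_preimage
    (MeasurableSet.univ_pi fun _ => measurableSet_Ioo).nullMeasurableSet, volume_pi_pi]
  simp [Real.volume_Ioo]

lemma volume_unitCube : volume (unitCube d) = 1 := by
  have := volume_box (d := d) (fun _ => 0) (fun _ => 1)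
  simpa [unitCube] using this

lemma cubeLaw_eq_restrict : cubeLaw d = volume.restrict (unitCube d) := by
  simp [cubeLaw, ProbabilityTheory.cond, volume_unitCube]

instance : IsProbabilityMeasure (cubeLaw d) := by
  constructor
  simp [cubeLaw_eq_restrict, volume_unitCube]

lemma ae_mem_unitCube : ∀ᵐ x ∂(cubeLaw d), x ∈ unitCube d := by
  rw [cubeLaw_eq_restrict]
  exact ae_restrict_mem isOpen_unitCube.measurableSet

lemma cubeLaw_pos_of_isOpen {s : Set (EuclideanSpace ℝ (Fin d))} (hs : IsOpen s)
    (h : (s ∩ unitCube d).Nonempty) : 0 < cubeLaw d s := by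
  rw [cubeLaw_eq_restrict, Measure.restrict_apply hs.measurableSet]
  exact (hs.inter isOpen_unitCube).measure_pos _ h

lemma cubeLaw_singleton (hd : 1 ≤ d) (x : EuclideanSpace ℝ (Fin d)) : cubeLaw d {x} = 0 := by
  have : NeZero d := ⟨by omega⟩
  have h : (volume : Measure (EuclideanSpace ℝ (Fin d))) {x} = 0 := measure_singleton x
  rw [cubeLaw_eq_restrict]
  exact le_antisymm ((Measure.restrict_apply_le _ _).trans h.le) bot_le

lemma cubeLaw_closedBall_le (u : EuclideanSpace ℝ (Fin d)) {r : ℝ} (hr : 0 ≤ r) :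
    cubeLaw d (Metric.closedBall u r) ≤
      ENNReal.ofReal (r ^ d) * volume (Metric.ball (0 : EuclideanSpace ℝ (Fin d)) 1) := by
  rw [cubeLaw_eq_restrict]
  refine (Measure.restrict_apply_le _ _).trans (le_of_eq ?_)
  rw [Measure.addHaar_closedBall volume u hr, finrank_euclideanSpace_fin]

lemma dist_le_sqrt_mul {x y : EuclideanSpace ℝ (Fin d)} {w : ℝ} (hw : 0 ≤ w)
    (h : ∀ k, |x k - y k| ≤ w) : dist x y ≤ √d * w := by
  rw [EuclideanSpace.dist_eq, ← Real.sqrt_sq hw, ← Real.sqrt_mul (Nat.cast_nonneg d)]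
  refine Real.sqrt_le_sqrt ?_
  calc ∑ k, dist (x k) (y k) ^ 2 ≤ ∑ _k : Fin d, w ^ 2 := by
        refine Finset.sum_le_sum fun k _ => ?_
        rw [Real.dist_eq]
        exact pow_le_pow_left₀ (abs_nonneg _) (h k) 2
    _ = d * w ^ 2 := by simp

lemma dist_le_sqrt_of_mem_unitCube {x y : EuclideanSpace ℝ (Fin d)} (hx : x ∈ unitCube d)
    (hy : y ∈ unitCube d) : dist x y ≤ √d := by
  have := dist_le_sqrt_mul (x := x) (y := y) zero_le_one fun k => by
    have h1 := hx k
    have h2 := hy k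
    rw [Set.mem_Ioo] at h1 h2
    rw [abs_le]
    constructor <;> linarith [h1.1, h1.2, h2.1, h2.2]
  simpa using this

/-- In each coordinate the interval of radius w about u k, cut down to (0,1), still has length at
least w, even next to the boundary. The resulting box lies in the ball. -/
lemma le_cubeLaw_closedBall {u : EuclideanSpace ℝ (Fin d)} (hu : u ∈ unitCube d) {w : ℝ}
    (hw : 0 ≤ w) (hw1 : w ≤ 1) :
    ENNReal.ofReal w ^ d ≤ cubeLaw d (Metric.closedBall u (√d * w)) := by
  rw [cubeLaw_eq_restrict, Measure.restrict_apply Metric.isClosed_closedBall.measurableSet]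
  have hsub : {x : EuclideanSpace ℝ (Fin d) |
      ∀ k, x k ∈ Set.Ioo (max 0 (u k - w)) (min 1 (u k + w))} ⊆
      Metric.closedBall u (√d * w) ∩ unitCube d := by
    intro x hx
    simp only [Set.mem_ofPred_eq, Set.mem_Ioo, max_lt_iff, lt_min_iff] at hx
    refine ⟨dist_le_sqrt_mul hw fun k => ?_, fun k => ⟨(hx k).1.1, (hx k).2.1⟩⟩
    rw [abs_le]
    constructor <;> linarith [(hx k).1.2, (hx k).2.2]
  refine le_trans ?_ (measure_mono hsub)
  rw [volume_box]
  calc ENNReal.ofReal w ^ d = ∏ _k : Fin d, ENNReal.ofReal w := by simp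
    _ ≤ _ := by
      refine Finset.prod_le_prod' fun k _ => ENNReal.ofReal_le_ofReal ?_
      obtain ⟨h0, h1⟩ := hu k
      rcases max_cases 0 (u k - w) with h | h <;> rcases min_cases 1 (u k + w) with h' | h' <;>
        linarith [h.1, h'.1]

end UniformLaw

/-! ### Distance to the nearest of finitely many points -/

section MinDist

variable {d : ℕ}

/-- Distance from `u` to the closest of the points `x 0, …, x n`. -/
def minDist (n : ℕ) (x : ℕ → EuclideanSpace ℝ (Fin d)) (u : EuclideanSpace ℝ (Fin d)) : ℝ :=
  (Finset.range (n + 1)).inf' Finset.nonempty_range_add_one fun i => dist u (x i)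

lemma lt_minDist_iff {n : ℕ} {x : ℕ → EuclideanSpace ℝ (Fin d)} {u : EuclideanSpace ℝ (Fin d)}
    {s : ℝ} : s < minDist n x u ↔ ∀ i ∈ Finset.range (n + 1), s < dist u (x i) :=
  Finset.lt_inf'_iff _

lemma le_minDist_iff {n : ℕ} {x : ℕ → EuclideanSpace ℝ (Fin d)} {u : EuclideanSpace ℝ (Fin d)}
    {s : ℝ} : s ≤ minDist n x u ↔ ∀ i ∈ Finset.range (n + 1), s ≤ dist u (x i) :=
  Finset.le_inf'_iff _ _

lemma minDist_nonneg (n : ℕ) (x : ℕ → EuclideanSpace ℝ (Fin d)) (u : EuclideanSpace ℝ (Fin d)) :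
    0 ≤ minDist n x u :=
  (Finset.le_inf'_iff _ _).2 fun _ _ => dist_nonneg

lemma minDist_le_dist {n i : ℕ} (hi : i ≤ n) (x : ℕ → EuclideanSpace ℝ (Fin d))
    (u : EuclideanSpace ℝ (Fin d)) : minDist n x u ≤ dist u (x i) :=
  Finset.inf'_le _ (Finset.mem_range.2 (Nat.lt_succ_of_le hi))

lemma minDist_congr {n : ℕ} {x y : ℕ → EuclideanSpace ℝ (Fin d)} (h : ∀ i ≤ n, x i = y i)
    (u : EuclideanSpace ℝ (Fin d)) : minDist n x u = minDist n y u :=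
  Finset.inf'_congr _ rfl fun i hi => by rw [h i (Nat.lt_succ_iff.1 (Finset.mem_range.1 hi))]

lemma minDist_update {n k : ℕ} (h : n < k) (x : ℕ → EuclideanSpace ℝ (Fin d))
    (v u : EuclideanSpace ℝ (Fin d)) : minDist n (Function.update x k v) u = minDist n x u :=
  minDist_congr (fun _ hi => Function.update_of_ne (Nat.ne_of_lt (hi.trans_lt h)) v x) u

lemma measurable_minDist (n : ℕ) : Measurable fun p :
    (ℕ → EuclideanSpace ℝ (Fin d)) × EuclideanSpace ℝ (Fin d) => minDist n p.1 p.2 := by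
  refine measurable_of_Ioi fun s => ?_
  have h : (fun p : (ℕ → EuclideanSpace ℝ (Fin d)) × EuclideanSpace ℝ (Fin d) =>
      minDist n p.1 p.2) ⁻¹' Set.Ioi s =
      ⋂ i ∈ Finset.range (n + 1), {p | s < dist p.2 (p.1 i)} := by
    ext p
    simp only [Set.mem_preimage, Set.mem_Ioi, lt_minDist_iff, Set.mem_iInter, Set.mem_ofPred_eq]
  rw [h]
  exact Finset.measurableSet_biInter _ fun i _ => measurableSet_lt (by fun_prop) (by fun_prop)

@[fun_prop]
lemma measurable_minDist_comp {X : Type*} [MeasurableSpace X] {n : ℕ}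
    {f : X → ℕ → EuclideanSpace ℝ (Fin d)} {g : X → EuclideanSpace ℝ (Fin d)}
    (hf : Measurable f) (hg : Measurable g) : Measurable fun a => minDist n (f a) (g a) := by
  have h := (measurable_minDist (d := d) n).comp (hf.prodMk hg)
  exact h

/-- `nnDist` discards the point itself from the set, so `minDist` computes it only if the new point
differs from its predecessors. Coincidences are null events by `ae_apply_ne`. -/
lemma nnDist_image_Iio {n : ℕ} {x : ℕ → EuclideanSpace ℝ (Fin d)}
    (h : ∀ i ≤ n, x i ≠ x (n + 1)) :
    nnDist (x (n + 1)) (x '' Set.Iio (n + 1)) = minDist n x (x (n + 1)) := by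
  have h1 : (x '' Set.Iio (n + 1)) \ {x (n + 1)} = x '' Set.Iio (n + 1) := by
    refine Set.sdiff_singleton_eq_self ?_
    rintro ⟨i, hi, hxi⟩
    exact h i (Nat.lt_succ_iff.1 hi) hxi
  rw [nnDist, h1]
  refine le_antisymm ((Finset.le_inf'_iff _ _).2 fun i hi => ?_) ?_
  · exact Metric.infDist_le_dist_of_mem (Set.mem_image_of_mem x (Finset.mem_range.1 hi))
  · refine (Metric.le_infDist (Set.Nonempty.image x ⟨0, Nat.succ_pos n⟩)).2 ?_
    rintro _ ⟨i, hi, rfl⟩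
    exact minDist_le_dist (Nat.lt_succ_iff.1 hi) x _

attribute [irreducible] minDist

end MinDist

end ONG

end

/-! ### Negative correlation of empty balls; moments of the nearest-neighbour distance -/

noncomputable section

namespace ONG

/-- If, on the event `G`, the upper level sets of two nonnegative variables are negatively
correlated, then so are, on `G`, the variables. -/
lemma setLIntegral_mul_le_of_negCorr {X : Type*} [MeasurableSpace X] {μ : Measure X} [SFinite μ]
    {a b : X → ℝ} (ha : Measurable a) (hb : Measurable b) (ha0 : 0 ≤ a) (hb0 : 0 ≤ b)
    {G : Set X}
    (h : ∀ s t, 0 < s → 0 < t → μ ({x | s < a x ∧ t < b x} ∩ G) ≤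
      μ {x | s < a x} * μ {x | t < b x}) :
    ∫⁻ x in G, ENNReal.ofReal (a x) * ENNReal.ofReal (b x) ∂μ ≤
      (∫⁻ x, ENNReal.ofReal (a x) ∂μ) * ∫⁻ x, ENNReal.ofReal (b x) ∂μ := by
  -- Layer-cake representation: each factor is the ρ-mass of a half-line, so the product is the mass
  -- of a rectangle and Tonelli reduces the claim to level sets.
  set ρ : Measure ℝ := volume.restrict (Set.Ioi 0) with hρ
  have hρI : ∀ c : ℝ, ρ (Set.Iio c) = ENNReal.ofReal c := fun c => by
    rw [hρ, Measure.restrict_apply measurableSet_Iio, Set.Iio_inter_Ioi, Real.volume_Ioo, sub_zero]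
  set S : Set (X × (ℝ × ℝ)) := {q | q.2.1 < a q.1 ∧ q.2.2 < b q.1} with hS
  have hSm : MeasurableSet S := by
    have h1 : MeasurableSet {q : X × (ℝ × ℝ) | q.2.1 < a q.1} :=
      measurableSet_lt (by fun_prop) (by fun_prop)
    have h2 : MeasurableSet {q : X × (ℝ × ℝ) | q.2.2 < b q.1} :=
      measurableSet_lt (by fun_prop) (by fun_prop)
    exact h1.inter h2
  have hae : ∀ᵐ p ∂(ρ.prod ρ), 0 < p.1 ∧ 0 < p.2 := by
    have h0 : ∀ᵐ s ∂ρ, (0 : ℝ) < s := ae_restrict_mem measurableSet_Ioi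
    exact (Measure.quasiMeasurePreserving_fst.ae h0).and
      (Measure.quasiMeasurePreserving_snd.ae h0)
  calc ∫⁻ x in G, ENNReal.ofReal (a x) * ENNReal.ofReal (b x) ∂μ
      = ∫⁻ x in G, (ρ.prod ρ) (Prod.mk x ⁻¹' S) ∂μ := by
        refine lintegral_congr fun x => ?_
        have : Prod.mk x ⁻¹' S = Set.Iio (a x) ×ˢ Set.Iio (b x) := by
          ext p
          simp [hS]
        rw [this, Measure.prod_prod, hρI, hρI]
    _ = ∫⁻ p, (μ.restrict G) ((fun x => (x, p)) ⁻¹' S) ∂(ρ.prod ρ) := by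
        rw [← Measure.prod_apply hSm, Measure.prod_apply_symm hSm]
    _ ≤ ∫⁻ p, μ {x | p.1 < a x} * μ {x | p.2 < b x} ∂(ρ.prod ρ) := by
        refine lintegral_mono_ae (hae.mono fun p hp => ?_)
        rw [Measure.restrict_apply (hSm.preimage (by fun_prop))]
        exact h p.1 p.2 hp.1 hp.2
    _ = (∫⁻ s, μ {x | s < a x} ∂ρ) * ∫⁻ t, μ {x | t < b x} ∂ρ := by
        have hm : ∀ c : X → ℝ, Antitone fun s : ℝ => μ {x | s < c x} :=
          fun c s t hst => measure_mono fun x hx => lt_of_le_of_lt hst hx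
        exact lintegral_prod_mul (hm a).measurable.aemeasurable (hm b).measurable.aemeasurable
    _ = _ := by
        rw [lintegral_eq_lintegral_meas_lt μ (ae_of_all _ ha0) ha.aemeasurable,
          lintegral_eq_lintegral_meas_lt μ (ae_of_all _ hb0) hb.aemeasurable]

/-- The law of a sequence of independent uniform points of the unit cube. -/
def seqLaw (d : ℕ) : Measure (ℕ → EuclideanSpace ℝ (Fin d)) :=
  Measure.infinitePi fun _ => cubeLaw d

instance (d : ℕ) : IsProbabilityMeasure (seqLaw d) :=
  inferInstanceAs (IsProbabilityMeasure (Measure.infinitePi _))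

variable {d : ℕ}

lemma seqLaw_forall_mem (n : ℕ) {T : Set (EuclideanSpace ℝ (Fin d))} (hT : MeasurableSet T) :
    seqLaw d {x | ∀ i ∈ Finset.range n, x i ∈ T} = cubeLaw d T ^ n := by
  have h : {x : ℕ → EuclideanSpace ℝ (Fin d) | ∀ i ∈ Finset.range n, x i ∈ T} =
      Set.pi (Finset.range n : Set ℕ) fun _ => T := by
    ext x
    simp [Set.mem_pi]
  rw [h, seqLaw, Measure.infinitePi_pi _ fun _ _ => hT]
  simp

lemma seqLaw_lt_minDist (n : ℕ) (u : EuclideanSpace ℝ (Fin d)) (s : ℝ) :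
    seqLaw d {x | s < minDist n x u} = cubeLaw d (Metric.closedBall u s)ᶜ ^ (n + 1) := by
  rw [← seqLaw_forall_mem (n + 1) Metric.isClosed_closedBall.measurableSet.compl]
  congr 1
  ext x
  simp [lt_minDist_iff, dist_comm]

/-- If disjoint balls have masses p and q, one point avoids both with probability 1 − p − q ≤ (1 −
p)(1 − q); independence raises this to the power n + 1. -/
lemma seqLaw_lt_minDist_and_le (n : ℕ) {u v : EuclideanSpace ℝ (Fin d)} {s t : ℝ}
    (h : s + t < dist u v) :
    seqLaw d {x | s < minDist n x u ∧ t < minDist n x v} ≤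
      seqLaw d {x | s < minDist n x u} * seqLaw d {x | t < minDist n x v} := by
  have hs : MeasurableSet (Metric.closedBall u s) := Metric.isClosed_closedBall.measurableSet
  have ht : MeasurableSet (Metric.closedBall v t) := Metric.isClosed_closedBall.measurableSet
  have h1 : {x : ℕ → EuclideanSpace ℝ (Fin d) | s < minDist n x u ∧ t < minDist n x v} =
      {x | ∀ i ∈ Finset.range (n + 1), x i ∈ (Metric.closedBall u s ∪ Metric.closedBall v t)ᶜ} := by
    ext x
    simp only [lt_minDist_iff, Set.mem_ofPred_eq, Set.compl_union, Set.mem_inter_iff,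
      Set.mem_compl_iff, Metric.mem_closedBall, not_le, dist_comm (x _), ← forall₂_and]
  rw [h1, seqLaw_forall_mem _ (hs.union ht).compl, seqLaw_lt_minDist, seqLaw_lt_minDist,
    ← mul_pow]
  gcongr
  have hdisj := Metric.closedBall_disjoint_closedBall h
  rw [← ENNReal.ofReal_toReal (measure_ne_top (cubeLaw d) (_ ∪ _)ᶜ),
    ← ENNReal.ofReal_toReal (measure_ne_top (cubeLaw d) (Metric.closedBall u s)ᶜ),
    ← ENNReal.ofReal_toReal (measure_ne_top (cubeLaw d) (Metric.closedBall v t)ᶜ),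
    ← ENNReal.ofReal_mul ENNReal.toReal_nonneg]
  refine ENNReal.ofReal_le_ofReal ?_
  simp only [← measureReal_def]
  rw [probReal_compl_eq_one_sub (hs.union ht), probReal_compl_eq_one_sub hs,
    probReal_compl_eq_one_sub ht, measureReal_union hdisj ht]
  nlinarith [measureReal_nonneg (μ := cubeLaw d) (s := Metric.closedBall u s),
    measureReal_nonneg (μ := cubeLaw d) (s := Metric.closedBall v t)]

/-- For s ≤ √d this is the lower bound on ball masses followed by 1 − x ≤ e^(−x); for larger s the
ball swallows the cube. -/
lemma cubeLaw_compl_closedBall_le (hd : 1 ≤ d) {u : EuclideanSpace ℝ (Fin d)}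
    (hu : u ∈ unitCube d) {s : ℝ} (hs : 0 ≤ s) :
    cubeLaw d (Metric.closedBall u s)ᶜ ≤ ENNReal.ofReal (Real.exp (-((s / √d) ^ d))) := by
  have hd0 : 0 < √(d : ℝ) := Real.sqrt_pos.2 (by exact_mod_cast hd)
  rcases le_or_gt s √d with h | h
  · have hw0 : 0 ≤ s / √d := by positivity
    have hw1 : s / √d ≤ 1 := (div_le_one hd0).2 h
    have h1 := le_cubeLaw_closedBall hu hw0 hw1
    rw [mul_div_cancel₀ _ hd0.ne'] at h1
    rw [prob_compl_eq_one_sub Metric.isClosed_closedBall.measurableSet]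
    calc 1 - cubeLaw d (Metric.closedBall u s) ≤ 1 - ENNReal.ofReal (s / √d) ^ d := by gcongr
      _ = ENNReal.ofReal (1 - (s / √d) ^ d) := by
          rw [ENNReal.ofReal_sub _ (by positivity), ENNReal.ofReal_pow hw0, ENNReal.ofReal_one]
      _ ≤ _ := ENNReal.ofReal_le_ofReal (by linarith [Real.add_one_le_exp (-((s / √d) ^ d))])
  · have h0 : cubeLaw d (Metric.closedBall u s)ᶜ = 0 := by
      have h1 : ∀ᵐ x ∂(cubeLaw d), x ∈ Metric.closedBall u s :=
        ae_mem_unitCube.mono fun x hx => (dist_le_sqrt_of_mem_unitCube hx hu).trans h.le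
      exact h1
    rw [h0]
    exact bot_le

/-- Moments of the nearest neighbour distance. -/
lemma exists_lintegral_minDist_rpow_le (hd : 1 ≤ d) {β : ℝ} (hβ : 0 < β) :
    ∃ C : ℝ, 0 ≤ C ∧ ∀ n : ℕ, ∀ u ∈ unitCube d,
      ∫⁻ x, ENNReal.ofReal (minDist n x u ^ β) ∂(seqLaw d) ≤
        ENNReal.ofReal (C * ((n : ℝ) + 1) ^ (-(β / d))) := by
  have hdp : (0 : ℝ) < d := by exact_mod_cast hd
  have hd0 : 0 < √(d : ℝ) := Real.sqrt_pos.2 hdp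
  -- With τ = s^β the tail exp(−(n+1) c s^d) becomes exp(−(n+1) c τ^p), whose integral is a Gamma
  -- value times (n+1)^(−1/p).
  set p : ℝ := d / β with hp
  have hp0 : 0 < p := by positivity
  set c : ℝ := ((√d) ^ d)⁻¹ with hc
  have hc0 : 0 < c := by positivity
  refine ⟨c ^ (-1 / p) * Real.Gamma (1 / p + 1),
    mul_nonneg (by positivity) (Real.Gamma_pos_of_pos (by positivity)).le, fun n u hu => ?_⟩
  have hmeas : Measurable fun x : ℕ → EuclideanSpace ℝ (Fin d) => minDist n x u ^ β :=
    (by fun_prop : Measurable fun x => minDist n x u).pow_const β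
  have hb0 : (0 : ℝ) < (n + 1) * c := by positivity
  rw [lintegral_eq_lintegral_meas_lt _
    (ae_of_all _ fun x => Real.rpow_nonneg (minDist_nonneg n x u) β) hmeas.aemeasurable]
  -- Were the function not integrable, its integral would be 0 by convention, but the Gamma formula
  -- gives a positive value.
  have h_int : IntegrableOn (fun τ : ℝ => Real.exp (-((n + 1) * c) * τ ^ p)) (Set.Ioi 0) := by
    by_contra hcon
    have h1 := integral_exp_neg_mul_rpow hp0 hb0
    rw [integral_undef hcon] at h1
    exact (mul_pos (Real.rpow_pos_of_pos hb0 _)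
      (Real.Gamma_pos_of_pos (by positivity : 0 < 1 / p + 1))).ne h1
  calc ∫⁻ τ in Set.Ioi 0, seqLaw d {x | τ < minDist n x u ^ β}
      ≤ ∫⁻ τ in Set.Ioi 0, ENNReal.ofReal (Real.exp (-((n + 1) * c) * τ ^ p)) := by
        refine setLIntegral_mono (by fun_prop) fun τ hτ => ?_
        have hτ0 : (0 : ℝ) < τ := hτ
        have hset : {x : ℕ → EuclideanSpace ℝ (Fin d) | τ < minDist n x u ^ β} =
            {x | τ ^ β⁻¹ < minDist n x u} := by
          ext x
          simp only [Set.mem_ofPred_eq]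
          rw [Real.rpow_inv_lt_iff_of_pos hτ0.le (minDist_nonneg n x u) hβ]
        rw [hset, seqLaw_lt_minDist]
        have hs : 0 ≤ τ ^ β⁻¹ := by positivity
        calc _ ≤ ENNReal.ofReal (Real.exp (-((τ ^ β⁻¹ / √d) ^ d))) ^ (n + 1) := by
              gcongr
              exact cubeLaw_compl_closedBall_le hd hu hs
          _ = _ := by
              rw [← ENNReal.ofReal_pow (Real.exp_pos _).le, ← Real.exp_nat_mul]
              congr 2
              rw [div_pow, ← Real.rpow_natCast (τ ^ β⁻¹) d, ← Real.rpow_mul hτ0.le, hp, hc,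
                show β⁻¹ * (d : ℝ) = d / β by ring]
              push_cast
              ring
    _ = ENNReal.ofReal (∫ τ in Set.Ioi 0, Real.exp (-((n + 1) * c) * τ ^ p)) :=
        (ofReal_integral_eq_lintegral_ofReal h_int
          (ae_of_all _ fun τ => (Real.exp_pos _).le)).symm
    _ = _ := by
        rw [integral_exp_neg_mul_rpow hp0 hb0, Real.mul_rpow (by positivity) hc0.le,
          show -(β / (d : ℝ)) = -1 / p by rw [hp]; field_simp]
        congr 1
        ring

end ONG

end

/-! ### Second moment of the conditional mean weight -/

noncomputable section

namespace ONG

variable {d : ℕ}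

/-- The `α`-th power of the distance from `u` to the closest of `x 0, …, x n`, as an extended
nonnegative real. -/
def ennWeight (α : ℝ) (n : ℕ) (x : ℕ → EuclideanSpace ℝ (Fin d))
    (u : EuclideanSpace ℝ (Fin d)) : ℝ≥0∞ :=
  ENNReal.ofReal (minDist n x u ^ α)

lemma measurable_ennWeight (α : ℝ) (n : ℕ) : Measurable fun p :
    (ℕ → EuclideanSpace ℝ (Fin d)) × EuclideanSpace ℝ (Fin d) => ennWeight α n p.1 p.2 :=
  ((measurable_minDist n).pow_const α).ennreal_ofReal

@[fun_prop]
lemma measurable_ennWeight_comp {X : Type*} [MeasurableSpace X] {α : ℝ} {n : ℕ}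
    {f : X → ℕ → EuclideanSpace ℝ (Fin d)} {g : X → EuclideanSpace ℝ (Fin d)}
    (hf : Measurable f) (hg : Measurable g) : Measurable fun a => ennWeight α n (f a) (g a) := by
  have h := (measurable_ennWeight (d := d) α n).comp (hf.prodMk hg)
  exact h

lemma exists_lintegral_lintegral_ennWeight_le (hd : 1 ≤ d) {β : ℝ} (hβ : 0 < β) :
    ∃ C : ℝ, 0 ≤ C ∧ ∀ n : ℕ,
      ∫⁻ x, ∫⁻ u, ennWeight β n x u ∂(cubeLaw d) ∂(seqLaw d) ≤
        ENNReal.ofReal (C * ((n : ℝ) + 1) ^ (-(β / d))) := by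
  obtain ⟨C, hC, h⟩ := exists_lintegral_minDist_rpow_le hd hβ
  refine ⟨C, hC, fun n => ?_⟩
  rw [lintegral_lintegral_swap (measurable_ennWeight β n).aemeasurable]
  calc _ ≤ ∫⁻ _u, ENNReal.ofReal (C * ((n : ℝ) + 1) ^ (-(β / d))) ∂(cubeLaw d) :=
        lintegral_mono_ae (ae_mem_unitCube.mono fun u hu => h n u hu)
    _ = _ := by simp

/-- The weights at two points are negatively correlated as long as the corresponding empty balls
are disjoint. -/
lemma lintegral_ennWeight_mul_le {α : ℝ} (hα : 0 < α) (n : ℕ) (u v : EuclideanSpace ℝ (Fin d)) :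
    ∫⁻ x, ennWeight α n x u * ennWeight α n x v ∂(seqLaw d) ≤
      (∫⁻ x, ennWeight α n x u ∂(seqLaw d)) * (∫⁻ x, ennWeight α n x v ∂(seqLaw d)) +
        ∫⁻ x in {x | dist u v ≤ minDist n x u + minDist n x v},
          ennWeight α n x u * ennWeight α n x v ∂(seqLaw d) := by
  have hm : ∀ w : EuclideanSpace ℝ (Fin d),
      Measurable fun x : ℕ → EuclideanSpace ℝ (Fin d) => minDist n x w := fun w => by fun_prop
  have hG : MeasurableSet {x : ℕ → EuclideanSpace ℝ (Fin d) |
      dist u v ≤ minDist n x u + minDist n x v} :=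
    measurableSet_le (f := fun _ => dist u v) (g := fun x => minDist n x u + minDist n x v)
      measurable_const ((hm u).add (hm v))
  rw [← lintegral_add_compl _ hG, add_comm]
  gcongr
  refine setLIntegral_mul_le_of_negCorr ((hm u).pow_const α) ((hm v).pow_const α)
    (fun x => Real.rpow_nonneg (minDist_nonneg n x u) α)
    (fun x => Real.rpow_nonneg (minDist_nonneg n x v) α) fun s t hs ht => ?_
  have hlt : ∀ {s : ℝ}, 0 < s → ∀ (x : ℕ → EuclideanSpace ℝ (Fin d)) w,
      s < minDist n x w ^ α ↔ s ^ α⁻¹ < minDist n x w := fun hs x w =>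
    (Real.rpow_inv_lt_iff_of_pos hs.le (minDist_nonneg n x w) hα).symm
  simp only [hlt hs, hlt ht]
  -- Either the balls of these radii are disjoint, or the two level sets already force the pair to
  -- be meeting and nothing is left on the complement.
  rcases lt_or_ge (s ^ α⁻¹ + t ^ α⁻¹) (dist u v) with h | h
  · exact (measure_mono Set.inter_subset_left).trans (seqLaw_lt_minDist_and_le n h)
  · have : {x : ℕ → EuclideanSpace ℝ (Fin d) |
        s ^ α⁻¹ < minDist n x u ∧ t ^ α⁻¹ < minDist n x v} ∩
        {x | dist u v ≤ minDist n x u + minDist n x v}ᶜ = ∅ := by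
      ext x
      simp only [Set.mem_inter_iff, Set.mem_ofPred_eq, Set.mem_compl_iff, not_le,
        Set.mem_empty_iff_false, iff_false]
      rintro ⟨⟨h1, h2⟩, h3⟩
      linarith
    rw [this, measure_empty]
    exact bot_le

/-- The larger of the two radii bounds both weights, and twice it bounds the distance of u and v.
The two summands record which radius is larger. -/
lemma ennWeight_mul_le {α : ℝ} (hα : 0 < α) {n : ℕ} {x : ℕ → EuclideanSpace ℝ (Fin d)}
    {u v : EuclideanSpace ℝ (Fin d)} (h : dist u v ≤ minDist n x u + minDist n x v) :
    ennWeight α n x u * ennWeight α n x v ≤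
      (Metric.closedBall u (2 * minDist n x u)).indicator (fun _ => ennWeight (2 * α) n x u) v +
      (Metric.closedBall v (2 * minDist n x v)).indicator (fun _ => ennWeight (2 * α) n x v) u := by
  have key : ∀ {u v : EuclideanSpace ℝ (Fin d)}, dist u v ≤ minDist n x u + minDist n x v →
      minDist n x v ≤ minDist n x u →
      ennWeight α n x u * ennWeight α n x v ≤
        (Metric.closedBall u (2 * minDist n x u)).indicator
          (fun _ => ennWeight (2 * α) n x u) v := by
    intro u v h hle
    have hv : v ∈ Metric.closedBall u (2 * minDist n x u) := by
      rw [Metric.mem_closedBall, dist_comm]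
      linarith
    rw [Set.indicator_of_mem hv, ennWeight, ennWeight, ennWeight,
      ← ENNReal.ofReal_mul (Real.rpow_nonneg (minDist_nonneg n x u) α)]
    refine ENNReal.ofReal_le_ofReal ?_
    have h2 : minDist n x u ^ (2 * α) = minDist n x u ^ α * minDist n x u ^ α := by
      rw [mul_comm, Real.rpow_mul (minDist_nonneg n x u), Real.rpow_two, sq]
    rw [h2]
    have := minDist_nonneg n x u
    have := minDist_nonneg n x v
    gcongr
  rcases le_total (minDist n x v) (minDist n x u) with hle | hle
  · exact (key h hle).trans le_self_add
  · rw [mul_comm]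
    refine (key ?_ hle).trans le_add_self
    rw [dist_comm]
    linarith

/-- Trades the volume of the ball for d further powers of the radius; this is the source of the
extra factor 1/n in the variance. -/
lemma lintegral_closedBall_ennWeight_le {β : ℝ} (n : ℕ) (x : ℕ → EuclideanSpace ℝ (Fin d))
    (hβ : 0 < β) (u : EuclideanSpace ℝ (Fin d)) :
    ∫⁻ v, (Metric.closedBall u (2 * minDist n x u)).indicator (fun _ => ennWeight β n x u) v
        ∂(cubeLaw d) ≤
      (ENNReal.ofReal (2 ^ d) * volume (Metric.ball (0 : EuclideanSpace ℝ (Fin d)) 1)) *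
        ennWeight (β + d) n x u := by
  have h0 := minDist_nonneg n x u
  rw [lintegral_indicator_const Metric.isClosed_closedBall.measurableSet]
  calc _ ≤ ennWeight β n x u * (ENNReal.ofReal ((2 * minDist n x u) ^ d) *
        volume (Metric.ball (0 : EuclideanSpace ℝ (Fin d)) 1)) := by
        gcongr
        exact cubeLaw_closedBall_le u (by positivity)
    _ = _ := by
        rw [ennWeight, ennWeight, mul_pow, ENNReal.ofReal_mul (by positivity),
          Real.rpow_add_natCast' h0 (by positivity), ENNReal.ofReal_mul (by positivity)]
        ring

/-- The pairs of points whose empty balls meet. -/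
def meetingPairs (n : ℕ) (x : ℕ → EuclideanSpace ℝ (Fin d)) :
    Set (EuclideanSpace ℝ (Fin d) × EuclideanSpace ℝ (Fin d)) :=
  {p | dist p.1 p.2 ≤ minDist n x p.1 + minDist n x p.2}

lemma measurableSet_meetingPairs (n : ℕ) :
    MeasurableSet {q : (ℕ → EuclideanSpace ℝ (Fin d)) ×
      (EuclideanSpace ℝ (Fin d) × EuclideanSpace ℝ (Fin d)) | q.2 ∈ meetingPairs n q.1} := by
  have h1 : Measurable fun q : (ℕ → EuclideanSpace ℝ (Fin d)) ×
      (EuclideanSpace ℝ (Fin d) × EuclideanSpace ℝ (Fin d)) => minDist n q.1 q.2.1 := by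
    fun_prop
  have h2 : Measurable fun q : (ℕ → EuclideanSpace ℝ (Fin d)) ×
      (EuclideanSpace ℝ (Fin d) × EuclideanSpace ℝ (Fin d)) => minDist n q.1 q.2.2 := by
    fun_prop
  have h3 : Measurable fun q : (ℕ → EuclideanSpace ℝ (Fin d)) ×
      (EuclideanSpace ℝ (Fin d) × EuclideanSpace ℝ (Fin d)) => dist q.2.1 q.2.2 := by
    fun_prop
  exact measurableSet_le h3 (h1.add h2)

lemma measurableSet_meetingPairs_right (n : ℕ) (x : ℕ → EuclideanSpace ℝ (Fin d)) :
    MeasurableSet (meetingPairs n x) := by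
  have h1 : Measurable fun p : EuclideanSpace ℝ (Fin d) × EuclideanSpace ℝ (Fin d) =>
      minDist n x p.1 + minDist n x p.2 := by
    fun_prop
  have h2 : Measurable fun p : EuclideanSpace ℝ (Fin d) × EuclideanSpace ℝ (Fin d) =>
      dist p.1 p.2 := by
    fun_prop
  exact measurableSet_le h2 h1

lemma measurableSet_meetingPairs_left (n : ℕ) (u v : EuclideanSpace ℝ (Fin d)) :
    MeasurableSet {x : ℕ → EuclideanSpace ℝ (Fin d) |
      dist u v ≤ minDist n x u + minDist n x v} := by
  have h1 : Measurable fun x : ℕ → EuclideanSpace ℝ (Fin d) =>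
      minDist n x u + minDist n x v := by
    fun_prop
  exact measurableSet_le measurable_const h1

lemma measurable_ennWeight_mul (α : ℝ) (n : ℕ) :
    Measurable fun q : (ℕ → EuclideanSpace ℝ (Fin d)) ×
      (EuclideanSpace ℝ (Fin d) × EuclideanSpace ℝ (Fin d)) =>
      ennWeight α n q.1 q.2.1 * ennWeight α n q.1 q.2.2 := by
  fun_prop

lemma lintegral_prod_add_swap {X : Type*} [MeasurableSpace X] {μ : Measure X} [SFinite μ]
    {F : X → X → ℝ≥0∞} (hF : Measurable (Function.uncurry F)) :
    ∫⁻ p, (F p.1 p.2 + F p.2 p.1) ∂(μ.prod μ) = 2 * ∫⁻ u, ∫⁻ v, F u v ∂μ ∂μ := by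
  have h1 := lintegral_prod (μ := μ) (ν := μ) (Function.uncurry F) hF.aemeasurable
  have h2 := lintegral_prod_swap (μ := μ) (ν := μ) (Function.uncurry F)
  simp only [Function.uncurry, Prod.fst_swap, Prod.snd_swap] at h1 h2
  rw [lintegral_add_left (f := fun p : X × X => F p.1 p.2) hF, h2, h1, two_mul]

lemma setLIntegral_meetingPairs_le {α : ℝ} (hα : 0 < α) (n : ℕ)
    (x : ℕ → EuclideanSpace ℝ (Fin d)) :
    ∫⁻ p in meetingPairs n x, ennWeight α n x p.1 * ennWeight α n x p.2
        ∂((cubeLaw d).prod (cubeLaw d)) ≤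
      2 * (ENNReal.ofReal (2 ^ d) * volume (Metric.ball (0 : EuclideanSpace ℝ (Fin d)) 1)) *
        ∫⁻ u, ennWeight (2 * α + d) n x u ∂(cubeLaw d) := by
  set κ : ℝ≥0∞ := ENNReal.ofReal (2 ^ d) * volume (Metric.ball (0 : EuclideanSpace ℝ (Fin d)) 1)
    with hκ
  have hκt : κ ≠ ∞ := ENNReal.mul_ne_top ENNReal.ofReal_ne_top measure_ball_lt_top.ne
  set F : EuclideanSpace ℝ (Fin d) → EuclideanSpace ℝ (Fin d) → ℝ≥0∞ := fun u v =>
    (Metric.closedBall u (2 * minDist n x u)).indicator (fun _ => ennWeight (2 * α) n x u) v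
    with hF
  have hFm : Measurable (Function.uncurry F) := by
    have h2 : Measurable fun p : EuclideanSpace ℝ (Fin d) × EuclideanSpace ℝ (Fin d) =>
        ennWeight (2 * α) n x p.1 := by
      fun_prop
    have h3 : MeasurableSet {p : EuclideanSpace ℝ (Fin d) × EuclideanSpace ℝ (Fin d) |
        dist p.2 p.1 ≤ 2 * minDist n x p.1} :=
      measurableSet_le (by fun_prop) (by fun_prop)
    exact h2.indicator h3
  have hGx := measurableSet_meetingPairs_right (d := d) n x
  have hone : ∫⁻ u, ∫⁻ v, F u v ∂(cubeLaw d) ∂(cubeLaw d) ≤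
      κ * ∫⁻ u, ennWeight (2 * α + d) n x u ∂(cubeLaw d) := by
    rw [← lintegral_const_mul' _ _ hκt]
    exact lintegral_mono fun u => lintegral_closedBall_ennWeight_le n x (by positivity) u
  calc _ ≤ ∫⁻ p in meetingPairs n x, (F p.1 p.2 + F p.2 p.1) ∂((cubeLaw d).prod (cubeLaw d)) :=
        setLIntegral_mono' hGx fun p hp => by
          have h : dist p.1 p.2 ≤ minDist n x p.1 + minDist n x p.2 := hp
          exact ennWeight_mul_le hα h
    _ ≤ ∫⁻ p, (F p.1 p.2 + F p.2 p.1) ∂((cubeLaw d).prod (cubeLaw d)) :=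
        setLIntegral_le_lintegral _ _
    _ = 2 * ∫⁻ u, ∫⁻ v, F u v ∂(cubeLaw d) ∂(cubeLaw d) := lintegral_prod_add_swap hFm
    _ ≤ _ := by
        rw [mul_assoc]
        gcongr

/-- The square is a double integral over (u, v). After exchanging it with the average over
sequences, negative correlation applies to each fixed pair, and the product terms reassemble into
the squared mean. -/
lemma lintegral_sq_lintegral_ennWeight_le {α : ℝ} (hα : 0 < α) (n : ℕ) :
    ∫⁻ x, (∫⁻ u, ennWeight α n x u ∂(cubeLaw d)) ^ 2 ∂(seqLaw d) ≤
      (∫⁻ x, ∫⁻ u, ennWeight α n x u ∂(cubeLaw d) ∂(seqLaw d)) ^ 2 +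
        ∫⁻ x, ∫⁻ p in meetingPairs n x, ennWeight α n x p.1 * ennWeight α n x p.2
          ∂((cubeLaw d).prod (cubeLaw d)) ∂(seqLaw d) := by
  have hw := measurable_ennWeight (d := d) α n
  have hjoint := measurable_ennWeight_mul (d := d) α n
  have hGm := measurableSet_meetingPairs (d := d) n
  have hfm : ∀ x, Measurable (ennWeight α n x : EuclideanSpace ℝ (Fin d) → ℝ≥0∞) := fun x => by
    fun_prop
  set g : (ℕ → EuclideanSpace ℝ (Fin d)) →
    EuclideanSpace ℝ (Fin d) × EuclideanSpace ℝ (Fin d) → ℝ≥0∞ := fun x p =>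
      (meetingPairs n x).indicator (fun p => ennWeight α n x p.1 * ennWeight α n x p.2) p with hg
  have hgm : Measurable (Function.uncurry g) := hjoint.indicator hGm
  have h1 : Measurable fun u => ∫⁻ x, ennWeight α n x u ∂(seqLaw d) :=
    Measurable.lintegral_prod_left' hw
  calc ∫⁻ x, (∫⁻ u, ennWeight α n x u ∂(cubeLaw d)) ^ 2 ∂(seqLaw d)
      = ∫⁻ x, ∫⁻ p, ennWeight α n x p.1 * ennWeight α n x p.2
          ∂((cubeLaw d).prod (cubeLaw d)) ∂(seqLaw d) := by
        refine lintegral_congr fun x => ?_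
        rw [sq, lintegral_prod_mul (hfm x).aemeasurable (hfm x).aemeasurable]
    _ = ∫⁻ p, ∫⁻ x, ennWeight α n x p.1 * ennWeight α n x p.2 ∂(seqLaw d)
          ∂((cubeLaw d).prod (cubeLaw d)) :=
        lintegral_lintegral_swap hjoint.aemeasurable
    _ ≤ ∫⁻ p, ((∫⁻ x, ennWeight α n x p.1 ∂(seqLaw d)) * (∫⁻ x, ennWeight α n x p.2 ∂(seqLaw d)) +
          ∫⁻ x, g x p ∂(seqLaw d)) ∂((cubeLaw d).prod (cubeLaw d)) := by
        refine lintegral_mono fun p => (lintegral_ennWeight_mul_le hα n p.1 p.2).trans_eq ?_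
        congr 1
        rw [← lintegral_indicator (measurableSet_meetingPairs_left n p.1 p.2)]
        rfl
    _ = (∫⁻ u, ∫⁻ x, ennWeight α n x u ∂(seqLaw d) ∂(cubeLaw d)) ^ 2 +
          ∫⁻ p, ∫⁻ x, g x p ∂(seqLaw d) ∂((cubeLaw d).prod (cubeLaw d)) := by
        have h2 : Measurable fun p : EuclideanSpace ℝ (Fin d) × EuclideanSpace ℝ (Fin d) =>
            (∫⁻ x, ennWeight α n x p.1 ∂(seqLaw d)) * ∫⁻ x, ennWeight α n x p.2 ∂(seqLaw d) :=
          (h1.comp measurable_fst).mul (h1.comp measurable_snd)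
        rw [lintegral_add_left h2, sq, ← lintegral_prod_mul h1.aemeasurable h1.aemeasurable]
    _ = _ := by
        rw [lintegral_lintegral_swap (f := fun p x => g x p)
            (hgm.comp measurable_swap).aemeasurable,
          ← lintegral_lintegral_swap hw.aemeasurable]
        congr 1
        refine lintegral_congr fun x => ?_
        exact lintegral_indicator (measurableSet_meetingPairs_right n x) _

/-- Second moment of the conditional mean of the next weight. -/
lemma exists_lintegral_sq_lintegral_ennWeight_le (hd : 1 ≤ d) {α : ℝ} (hα : 0 < α) :
    ∃ C : ℝ, 0 ≤ C ∧ ∀ n : ℕ,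
      ∫⁻ x, (∫⁻ u, ennWeight α n x u ∂(cubeLaw d)) ^ 2 ∂(seqLaw d) ≤
        (∫⁻ x, ∫⁻ u, ennWeight α n x u ∂(cubeLaw d) ∂(seqLaw d)) ^ 2 +
          ENNReal.ofReal (C * ((n : ℝ) + 1) ^ (-(1 + 2 * (α / d)))) := by
  have hdp : (0 : ℝ) < d := by exact_mod_cast hd
  obtain ⟨C, hC, hmom⟩ := exists_lintegral_lintegral_ennWeight_le hd
    (by positivity : 0 < 2 * α + d)
  have hrem := setLIntegral_meetingPairs_le (d := d) hα
  set κ : ℝ≥0∞ := ENNReal.ofReal (2 ^ d) * volume (Metric.ball (0 : EuclideanSpace ℝ (Fin d)) 1)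
    with hκ
  have hκt : κ ≠ ∞ := ENNReal.mul_ne_top ENNReal.ofReal_ne_top measure_ball_lt_top.ne
  refine ⟨2 * κ.toReal * C, by positivity, fun n => ?_⟩
  refine (lintegral_sq_lintegral_ennWeight_le hα n).trans ?_
  gcongr
  calc _ ≤ ∫⁻ x, 2 * κ * ∫⁻ u, ennWeight (2 * α + d) n x u ∂(cubeLaw d) ∂(seqLaw d) :=
        lintegral_mono (hrem n)
    _ = 2 * κ * ∫⁻ x, ∫⁻ u, ennWeight (2 * α + d) n x u ∂(cubeLaw d) ∂(seqLaw d) :=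
        lintegral_const_mul' _ _ (ENNReal.mul_ne_top (by simp) hκt)
    _ ≤ 2 * κ * ENNReal.ofReal (C * ((n : ℝ) + 1) ^ (-((2 * α + d) / d))) := by
        gcongr
        exact hmom n
    _ = _ := by
        rw [mul_assoc (2 * κ.toReal), ENNReal.ofReal_mul (by positivity : 0 ≤ 2 * κ.toReal),
          ENNReal.ofReal_mul zero_le_two, ENNReal.ofReal_toReal hκt,
          show (2 * α + d) / (d : ℝ) = 1 + 2 * (α / d) by field_simp; ring]
        simp

end ONG

end

/-! ### Martingale decomposition and convergence in L² -/

noncomputable section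

namespace ONG

section HilbertSpace

/-- A series of pairwise orthogonal vectors with summable squared norms is summable. -/
lemma summable_of_pairwise_inner_eq_zero {H : Type*} [NormedAddCommGroup H]
    [InnerProductSpace ℝ H] [CompleteSpace H] {v : ℕ → H}
    (hv : ∀ i j, i < j → inner ℝ (v i) (v j) = 0) (hs : Summable fun i => ‖v i‖ ^ 2) :
    Summable v := by
  have hne : ∀ i j, i ≠ j → inner ℝ (v i) (v j) = 0 := fun i j hij => by
    rcases lt_or_gt_of_ne hij with h | h
    · exact hv i j h
    · rw [real_inner_comm]
      exact hv j i h
  have hV : OrthogonalFamily ℝ (fun i => Submodule.span ℝ {v i})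
      fun i => (Submodule.span ℝ {v i}).subtypeₗᵢ := by
    rintro i j hij ⟨a, ha⟩ ⟨b, hb⟩
    obtain ⟨r, rfl⟩ := Submodule.mem_span_singleton.1 ha
    obtain ⟨s, rfl⟩ := Submodule.mem_span_singleton.1 hb
    simp [inner_smul_left, inner_smul_right, hne i j hij]
  exact (hV.summable_iff_norm_sq_summable
    fun i => ⟨v i, Submodule.mem_span_singleton_self (v i)⟩).2 hs

variable {X : Type*} [MeasurableSpace X] {μ : Measure X}

lemma inner_toLp_toLp {f g : X → ℝ} (hf : MemLp f 2 μ) (hg : MemLp g 2 μ) :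
    inner ℝ (hf.toLp f) (hg.toLp g) = ∫ x, f x * g x ∂μ := by
  rw [L2.inner_def]
  refine integral_congr_ae ?_
  filter_upwards [hf.coeFn_toLp, hg.coeFn_toLp] with x h1 h2
  rw [h1, h2]
  simp [mul_comm]

lemma norm_sq_toLp {f : X → ℝ} (hf : MemLp f 2 μ) : ‖hf.toLp f‖ ^ 2 = ∫ x, f x ^ 2 ∂μ := by
  rw [← real_inner_self_eq_norm_sq, inner_toLp_toLp hf hf]
  simp only [sq]

end HilbertSpace

variable {d : ℕ}

lemma measurePreserving_eval_seqLaw (i : ℕ) :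
    MeasurePreserving (fun x : ℕ → EuclideanSpace ℝ (Fin d) => x i) (seqLaw d) (cubeLaw d) :=
  measurePreserving_eval_infinitePi (fun _ : ℕ => cubeLaw d) i

lemma ae_forall_mem_unitCube : ∀ᵐ x ∂(seqLaw d), ∀ i, x i ∈ unitCube d :=
  ae_all_iff.2 fun i => (measurePreserving_eval_seqLaw i).quasiMeasurePreserving.ae ae_mem_unitCube

/-- Resampling one point of the sequence does not change the law of the sequence. -/
lemma measurePreserving_update (k : ℕ) :
    MeasurePreserving (fun p : (ℕ → EuclideanSpace ℝ (Fin d)) × EuclideanSpace ℝ (Fin d) =>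
      Function.update p.1 k p.2) ((seqLaw d).prod (cubeLaw d)) (seqLaw d) := by
  have hm : Measurable fun p : (ℕ → EuclideanSpace ℝ (Fin d)) × EuclideanSpace ℝ (Fin d) =>
      Function.update p.1 k p.2 := by
    refine measurable_pi_iff.2 fun i => ?_
    rcases eq_or_ne i k with rfl | h
    · simpa using measurable_snd
    · simp only [Function.update_of_ne h]
      fun_prop
  refine ⟨hm, Measure.eq_infinitePi _ fun s t ht => ?_⟩
  rw [Measure.map_apply hm (MeasurableSet.pi s.countable_toSet fun i _ => ht i)]
  have hset : (fun p : (ℕ → EuclideanSpace ℝ (Fin d)) × EuclideanSpace ℝ (Fin d) =>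
      Function.update p.1 k p.2) ⁻¹' Set.pi (s : Set ℕ) t =
      Set.pi ((s.erase k : Finset ℕ) : Set ℕ) t ×ˢ (if k ∈ s then t k else Set.univ) := by
    ext p
    simp only [Set.mem_preimage, Set.mem_pi, Finset.mem_coe, Set.mem_prod, Finset.mem_erase]
    constructor
    · intro h
      refine ⟨fun i hi => by simpa [Function.update_of_ne hi.1] using h i hi.2, ?_⟩
      split_ifs with hk
      · simpa using h k hk
      · trivial
    · rintro ⟨h1, h2⟩ i hi
      rcases eq_or_ne i k with rfl | hik
      · rw [if_pos hi] at h2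
        simpa using h2
      · rw [Function.update_of_ne hik]
        exact h1 i ⟨hik, hi⟩
  rw [hset, Measure.prod_prod, seqLaw, Measure.infinitePi_pi _ fun i _ => ht i]
  split_ifs with hk
  · exact Finset.prod_erase_mul s (fun i => cubeLaw d (t i)) hk
  · rw [measure_univ, mul_one, Finset.erase_eq_of_notMem hk]

/-- The weight of the edge that joins the point of index `n + 1` to its nearest predecessor. -/
def edgeWeight (α : ℝ) (n : ℕ) (x : ℕ → EuclideanSpace ℝ (Fin d)) : ℝ :=
  minDist n x (x (n + 1)) ^ α

/-- The mean weight of the edge from the point of index `n + 1`, given its predecessors. -/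
def condWeight (α : ℝ) (n : ℕ) (x : ℕ → EuclideanSpace ℝ (Fin d)) : ℝ :=
  ∫ u, minDist n x u ^ α ∂(cubeLaw d)

variable {α : ℝ}

lemma edgeWeight_nonneg (α : ℝ) (n : ℕ) (x : ℕ → EuclideanSpace ℝ (Fin d)) :
    0 ≤ edgeWeight α n x :=
  Real.rpow_nonneg (minDist_nonneg n x _) α

lemma condWeight_nonneg (α : ℝ) (n : ℕ) (x : ℕ → EuclideanSpace ℝ (Fin d)) :
    0 ≤ condWeight α n x :=
  integral_nonneg fun u => Real.rpow_nonneg (minDist_nonneg n x u) α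

lemma measurable_edgeWeight (α : ℝ) (n : ℕ) :
    Measurable (edgeWeight α n : (ℕ → EuclideanSpace ℝ (Fin d)) → ℝ) := by
  have : Measurable fun x : ℕ → EuclideanSpace ℝ (Fin d) => minDist n x (x (n + 1)) := by fun_prop
  exact this.pow_const α

lemma measurable_condWeight (α : ℝ) (n : ℕ) :
    Measurable (condWeight α n : (ℕ → EuclideanSpace ℝ (Fin d)) → ℝ) := by
  have : Measurable fun p : (ℕ → EuclideanSpace ℝ (Fin d)) × EuclideanSpace ℝ (Fin d) =>
      minDist n p.1 p.2 ^ α := (measurable_minDist n).pow_const α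
  exact this.stronglyMeasurable.integral_prod_right'.measurable

/-- A point in the cube bounds the distances, so the Bochner integral is a genuine one and not the
default value 0. -/
lemma ofReal_condWeight (hα : 0 < α) {n : ℕ} {x : ℕ → EuclideanSpace ℝ (Fin d)}
    (hx : x 0 ∈ unitCube d) :
    ENNReal.ofReal (condWeight α n x) = ∫⁻ u, ennWeight α n x u ∂(cubeLaw d) := by
  refine ofReal_integral_eq_lintegral_ofReal ?_
    (ae_of_all _ fun u => Real.rpow_nonneg (minDist_nonneg n x u) α)
  have hm : Measurable fun u : EuclideanSpace ℝ (Fin d) => minDist n x u := by fun_prop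
  refine Integrable.of_bound (hm.pow_const α).aestronglyMeasurable (√d ^ α)
    (ae_mem_unitCube.mono fun u hu => ?_)
  rw [Real.norm_of_nonneg (Real.rpow_nonneg (minDist_nonneg n x u) α)]
  exact Real.rpow_le_rpow (minDist_nonneg n x u)
    ((minDist_le_dist (Nat.zero_le n) x u).trans (dist_le_sqrt_of_mem_unitCube hu hx)) hα.le

lemma edgeWeight_le (hα : 0 < α) (n : ℕ) :
    ∀ᵐ x ∂(seqLaw d), edgeWeight α n x ≤ √d ^ α := by
  filter_upwards [ae_forall_mem_unitCube] with x hx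
  exact Real.rpow_le_rpow (minDist_nonneg n x _) ((minDist_le_dist (Nat.zero_le n) x _).trans
    (dist_le_sqrt_of_mem_unitCube (hx _) (hx _))) hα.le

lemma condWeight_le (hα : 0 < α) (n : ℕ) :
    ∀ᵐ x ∂(seqLaw d), condWeight α n x ≤ √d ^ α := by
  filter_upwards [ae_forall_mem_unitCube] with x hx
  have h0 : (0 : ℝ) ≤ √d ^ α := by positivity
  rw [← ENNReal.ofReal_le_ofReal_iff h0, ofReal_condWeight hα (hx 0)]
  calc ∫⁻ u, ennWeight α n x u ∂(cubeLaw d)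
      ≤ ∫⁻ _u, ENNReal.ofReal (√d ^ α) ∂(cubeLaw d) := by
        refine lintegral_mono_ae (ae_mem_unitCube.mono fun u hu => ENNReal.ofReal_le_ofReal ?_)
        exact Real.rpow_le_rpow (minDist_nonneg n x u)
          ((minDist_le_dist (Nat.zero_le n) x u).trans
            (dist_le_sqrt_of_mem_unitCube hu (hx 0))) hα.le
    _ = _ := by simp

lemma memLp_edgeWeight (hα : 0 < α) (n : ℕ) : MemLp (edgeWeight α n) 2 (seqLaw d) :=
  MemLp.of_bound (measurable_edgeWeight α n).aestronglyMeasurable (√d ^ α)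
    ((edgeWeight_le hα n).mono fun x hx => by rwa [Real.norm_of_nonneg (edgeWeight_nonneg α n x)])

lemma memLp_condWeight (hα : 0 < α) (n : ℕ) : MemLp (condWeight α n) 2 (seqLaw d) :=
  MemLp.of_bound (measurable_condWeight α n).aestronglyMeasurable (√d ^ α)
    ((condWeight_le hα n).mono fun x hx => by rwa [Real.norm_of_nonneg (condWeight_nonneg α n x)])

/-- `condWeight` is the conditional mean of `edgeWeight`. -/
lemma integral_edgeWeight_mul {n : ℕ} {g : (ℕ → EuclideanSpace ℝ (Fin d)) → ℝ}
    (hg : ∀ x u, g (Function.update x (n + 1) u) = g x)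
    (h_int : Integrable (fun x => edgeWeight α n x * g x) (seqLaw d)) :
    ∫ x, edgeWeight α n x * g x ∂(seqLaw d) = ∫ x, condWeight α n x * g x ∂(seqLaw d) := by
  -- Resampling the point n + 1 changes neither g nor the predecessors, so Fubini in the resampled
  -- coordinate does the work of a conditional expectation.
  have hmp := measurePreserving_update (d := d) (n + 1)
  have hcomp : ∀ p : (ℕ → EuclideanSpace ℝ (Fin d)) × EuclideanSpace ℝ (Fin d),
      edgeWeight α n (Function.update p.1 (n + 1) p.2) * g (Function.update p.1 (n + 1) p.2) =
        minDist n p.1 p.2 ^ α * g p.1 := fun p => by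
    rw [hg, edgeWeight, minDist_update (Nat.lt_succ_self n), Function.update_self]
  have h1 : ∫ x, edgeWeight α n x * g x ∂(seqLaw d) =
      ∫ p, minDist n p.1 p.2 ^ α * g p.1 ∂((seqLaw d).prod (cubeLaw d)) := by
    conv_lhs => rw [← hmp.map_eq]
    rw [integral_map hmp.measurable.aemeasurable (by rw [hmp.map_eq]; exact h_int.1)]
    exact integral_congr_ae (ae_of_all _ hcomp)
  have h2 : Integrable (fun p : (ℕ → EuclideanSpace ℝ (Fin d)) × EuclideanSpace ℝ (Fin d) =>
      minDist n p.1 p.2 ^ α * g p.1) ((seqLaw d).prod (cubeLaw d)) := by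
    have := hmp.integrable_comp_of_integrable h_int
    exact this.congr (ae_of_all _ hcomp)
  rw [h1, integral_prod _ h2]
  refine integral_congr_ae (ae_of_all _ fun x => ?_)
  exact integral_mul_const (g x) fun u => minDist n x u ^ α

lemma condWeight_update {n k : ℕ} (h : n < k) (x : ℕ → EuclideanSpace ℝ (Fin d))
    (u : EuclideanSpace ℝ (Fin d)) :
    condWeight α n (Function.update x k u) = condWeight α n x := by
  simp only [condWeight, minDist_update h]

lemma edgeWeight_update {n k : ℕ} (h : n + 1 < k) (x : ℕ → EuclideanSpace ℝ (Fin d))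
    (u : EuclideanSpace ℝ (Fin d)) :
    edgeWeight α n (Function.update x k u) = edgeWeight α n x := by
  simp only [edgeWeight, minDist_update (Nat.lt_of_succ_lt h), Function.update_of_ne h.ne]

lemma integral_edgeWeight (hα : 0 < α) (n : ℕ) :
    ∫ x, edgeWeight α n x ∂(seqLaw d) = ∫ x, condWeight α n x ∂(seqLaw d) := by
  have := integral_edgeWeight_mul (d := d) (α := α) (n := n) (g := fun _ => 1) (fun _ _ => rfl)
    (by simpa using (memLp_edgeWeight hα n).integrable one_le_two)
  simpa using this

/-- Resampling the endpoint carries the moment bounds at a deterministic u over to the edge weights.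
-/
lemma lintegral_edgeWeight (β : ℝ) (n : ℕ) :
    ∫⁻ x, ENNReal.ofReal (edgeWeight β n x) ∂(seqLaw d) =
      ∫⁻ x, ∫⁻ u, ennWeight β n x u ∂(cubeLaw d) ∂(seqLaw d) := by
  have hmp := measurePreserving_update (d := d) (n + 1)
  rw [← hmp.lintegral_comp (measurable_edgeWeight β n).ennreal_ofReal,
    ← lintegral_prod _ (measurable_ennWeight (d := d) β n).aemeasurable]
  refine lintegral_congr fun p => ?_
  rw [edgeWeight, minDist_update (Nat.lt_succ_self n), Function.update_self, ennWeight]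

lemma exists_integral_edgeWeight_le (hd : 1 ≤ d) {β : ℝ} (hβ : 0 < β) :
    ∃ C : ℝ, 0 ≤ C ∧ ∀ n : ℕ, ∫ x, edgeWeight β n x ∂(seqLaw d) ≤
      C * ((n : ℝ) + 1) ^ (-(β / d)) := by
  obtain ⟨C, hC, h⟩ := exists_lintegral_lintegral_ennWeight_le hd hβ
  refine ⟨C, hC, fun n => ?_⟩
  rw [← ENNReal.ofReal_le_ofReal_iff (by positivity),
    ofReal_integral_eq_lintegral_ofReal ((memLp_edgeWeight hβ n).integrable one_le_two)
      (ae_of_all _ fun x => edgeWeight_nonneg β n x), lintegral_edgeWeight]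
  exact h n

lemma edgeWeight_sq (α : ℝ) (n : ℕ) (x : ℕ → EuclideanSpace ℝ (Fin d)) :
    edgeWeight α n x ^ 2 = edgeWeight (2 * α) n x := by
  rw [edgeWeight, edgeWeight, mul_comm, Real.rpow_mul (minDist_nonneg n x _), Real.rpow_two]

/-- The squared mean in the second-moment bound cancels exactly, leaving the contribution of the
meeting pairs. -/
lemma exists_variance_condWeight_le (hd : 1 ≤ d) (hα : 0 < α) :
    ∃ C : ℝ, 0 ≤ C ∧ ∀ n : ℕ,
      ∫ x, (condWeight α n x - ∫ y, condWeight α n y ∂(seqLaw d)) ^ 2 ∂(seqLaw d) ≤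
        C * ((n : ℝ) + 1) ^ (-(1 + 2 * (α / d))) := by
  obtain ⟨C, hC, h⟩ := exists_lintegral_sq_lintegral_ennWeight_le hd hα
  refine ⟨C, hC, fun n => ?_⟩
  have hL2 := memLp_condWeight (d := d) hα n
  have h_int := hL2.integrable one_le_two
  have hvar : ∫ x, (condWeight α n x - ∫ y, condWeight α n y ∂(seqLaw d)) ^ 2 ∂(seqLaw d) =
      ∫ x, condWeight α n x ^ 2 ∂(seqLaw d) - (∫ x, condWeight α n x ∂(seqLaw d)) ^ 2 := by
    rw [← variance_eq_integral h_int.aemeasurable, variance_eq_sub hL2]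
    rfl
  have hmean : ENNReal.ofReal (∫ x, condWeight α n x ∂(seqLaw d)) =
      ∫⁻ x, ∫⁻ u, ennWeight α n x u ∂(cubeLaw d) ∂(seqLaw d) := by
    rw [ofReal_integral_eq_lintegral_ofReal h_int (ae_of_all _ fun x => condWeight_nonneg α n x)]
    exact lintegral_congr_ae (ae_forall_mem_unitCube.mono fun x hx => ofReal_condWeight hα (hx 0))
  have hsq : ENNReal.ofReal (∫ x, condWeight α n x ^ 2 ∂(seqLaw d)) =
      ∫⁻ x, (∫⁻ u, ennWeight α n x u ∂(cubeLaw d)) ^ 2 ∂(seqLaw d) := by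
    rw [ofReal_integral_eq_lintegral_ofReal hL2.integrable_sq (ae_of_all _ fun x => sq_nonneg _)]
    refine lintegral_congr_ae (ae_forall_mem_unitCube.mono fun x hx => ?_)
    simp only
    rw [← ofReal_condWeight hα (hx 0), ENNReal.ofReal_pow (condWeight_nonneg α n x)]
  have h0 : 0 ≤ ∫ x, condWeight α n x ∂(seqLaw d) := integral_nonneg fun x => condWeight_nonneg α n x
  have hn := h n
  rw [← hmean, ← hsq, ← ENNReal.ofReal_pow h0, ← ENNReal.ofReal_add (by positivity) (by positivity),
    ENNReal.ofReal_le_ofReal_iff (by positivity)] at hn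
  rw [hvar]
  linarith

/-- The centred total weight of the first `n` edges. -/
def centredWeight (α : ℝ) (n : ℕ) (x : ℕ → EuclideanSpace ℝ (Fin d)) : ℝ :=
  ∑ k ∈ Finset.range n, (edgeWeight α k x - ∫ y, edgeWeight α k y ∂(seqLaw d))

lemma memLp_centredWeight (hα : 0 < α) (n : ℕ) : MemLp (centredWeight α n) 2 (seqLaw d) :=
  memLp_finsetSum _ fun k _ => (memLp_edgeWeight hα k).sub (memLp_const _)

/-- The centred total weights converge in mean square. -/
theorem exists_tendsto_centredWeight (hd : 1 ≤ d) (hα : (d : ℝ) / 2 < α) :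
    ∃ Q : (ℕ → EuclideanSpace ℝ (Fin d)) → ℝ, Measurable Q ∧ MemLp Q 2 (seqLaw d) ∧
      Tendsto (fun n => eLpNorm (centredWeight α n - Q) 2 (seqLaw d)) atTop (𝓝 0) := by
  have hdp : (0 : ℝ) < d := by exact_mod_cast hd
  have hα0 : 0 < α := by linarith
  have hγ : 1 / 2 < α / d := by
    rw [lt_div_iff₀ hdp]
    linarith
  have hZ := memLp_edgeWeight (d := d) hα0
  have hW := memLp_condWeight (d := d) hα0
  have hsummable : ∀ {s : ℝ}, 1 < s → Summable fun n : ℕ => ((n : ℝ) + 1) ^ (-s) := fun {s} hs => by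
    have h1 := (summable_nat_add_iff 1).2 (Real.summable_nat_rpow.2 (by linarith : -s < -1))
    simpa using h1
  have ha := fun n => (hZ n).sub (hW n)
  have hb := fun n => (hW n).sub (memLp_const (∫ y, condWeight α n y ∂(seqLaw d)))
  -- The i-th difference involves only the points up to i + 1 < j + 1, so resampling the point j + 1
  -- fixes it and annihilates the j-th difference.
  have hortho : ∀ i j, i < j → inner ℝ ((ha i).toLp _) ((ha j).toLp _) = 0 := by
    intro i j hij
    rw [inner_toLp_toLp]
    have hi1 : Integrable (fun x => edgeWeight α j x * (edgeWeight α i x - condWeight α i x))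
        (seqLaw d) := (hZ j).integrable_mul (ha i)
    have hi2 : Integrable (fun x => condWeight α j x * (edgeWeight α i x - condWeight α i x))
        (seqLaw d) := (hW j).integrable_mul (ha i)
    have := integral_edgeWeight_mul (d := d) (α := α) (n := j)
      (g := fun x => edgeWeight α i x - condWeight α i x)
      (fun x u => by rw [edgeWeight_update (by omega), condWeight_update (by omega)]) hi1
    rw [← sub_eq_zero, ← integral_sub hi1 hi2] at this
    rw [← this]
    refine integral_congr_ae (ae_of_all _ fun x => ?_)
    simp only [Pi.sub_apply]
    ring
  -- E(Z − W)² = E Z² − E W² ≤ E Z², and Z² is an edge weight of exponent 2α, with 2α/d > 1.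
  have hnorm : Summable fun n => ‖(ha n).toLp (edgeWeight α n - condWeight α n)‖ ^ 2 := by
    obtain ⟨C, hC, hbound⟩ := exists_integral_edgeWeight_le hd (by positivity : 0 < 2 * α)
    refine Summable.of_nonneg_of_le (fun n => sq_nonneg _) (fun n => ?_)
      ((hsummable (by linarith : 1 < 2 * (α / d))).mul_left C)
    rw [norm_sq_toLp, ← mul_div_assoc]
    refine le_trans ?_ (hbound n)
    have hi1 : Integrable (fun x => edgeWeight α n x * condWeight α n x) (seqLaw d) :=
      (hZ n).integrable_mul (hW n)
    have hi2 : Integrable (fun x => condWeight α n x * condWeight α n x) (seqLaw d) :=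
      (hW n).integrable_mul (hW n)
    have h1 := integral_edgeWeight_mul (d := d) (α := α) (n := n)
      (g := condWeight α n) (fun x u => condWeight_update (Nat.lt_succ_self n) x u) hi1
    have h2 : ∫ x, (edgeWeight α n x - condWeight α n x) ^ 2 ∂(seqLaw d) =
        ∫ x, edgeWeight α n x ^ 2 ∂(seqLaw d) - 2 * ∫ x, edgeWeight α n x * condWeight α n x
          ∂(seqLaw d) + ∫ x, condWeight α n x * condWeight α n x ∂(seqLaw d) := by
      have hi3 : Integrable (fun x => edgeWeight α n x ^ 2 -
          2 * (edgeWeight α n x * condWeight α n x)) (seqLaw d) :=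
        (hZ n).integrable_sq.sub (hi1.const_mul 2)
      rw [← integral_const_mul, ← integral_sub (hZ n).integrable_sq (hi1.const_mul 2),
        ← integral_add hi3 hi2]
      refine integral_congr_ae (ae_of_all _ fun x => ?_)
      ring
    have h3 : 0 ≤ ∫ x, condWeight α n x * condWeight α n x ∂(seqLaw d) :=
      integral_nonneg fun x => mul_self_nonneg _
    simp only [edgeWeight_sq] at h2
    simp only [Pi.sub_apply]
    linarith
  have hsum1 := summable_of_pairwise_inner_eq_zero hortho hnorm
  -- No orthogonality is used here: the norm is at most √C (n+1)^(−(1/2 + α/d)), and this exponent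
  -- exceeds 1 in absolute value.
  have hsum2 : Summable fun n => (hb n).toLp _ := by
    obtain ⟨C, hC, hbound⟩ := exists_variance_condWeight_le hd hα0
    refine Summable.of_norm_bounded
      ((hsummable (by linarith : 1 < 1 / 2 + α / d)).mul_left √C) fun n => ?_
    refine le_of_sq_le_sq ?_ (by positivity)
    rw [norm_sq_toLp, mul_pow, Real.sq_sqrt hC, ← Real.rpow_mul_natCast (by positivity)]
    refine (hbound n).trans_eq ?_
    congr 2
    push_cast
    ring
  have hlim := (hsum1.add hsum2).hasSum.tendsto_sum_nat
  set q := ∑' n, ((ha n).toLp _ + (hb n).toLp _) with hq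
  refine ⟨q, (Lp.stronglyMeasurable q).measurable, Lp.memLp q, ?_⟩
  rw [Lp.tendsto_Lp_iff_tendsto_eLpNorm'] at hlim
  refine hlim.congr fun n => eLpNorm_congr_ae ?_
  refine EventuallyEq.sub ?_ EventuallyEq.rfl
  have h1 : ∑ k ∈ Finset.range n, ((ha k).toLp (edgeWeight α k - condWeight α k) +
      (hb k).toLp (condWeight α k - fun _ => ∫ y, condWeight α k y ∂(seqLaw d))) =
      (memLp_centredWeight hα0 n).toLp (centredWeight α n) := by
    induction n with
    | zero =>
      symm
      rw [Finset.sum_range_zero, Lp.eq_zero_iff_ae_eq_zero]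
      filter_upwards [(memLp_centredWeight (d := d) hα0 0).coeFn_toLp] with x hx
      rw [hx]
      simp [centredWeight]
    | succ n ih =>
      rw [Finset.sum_range_succ, ih, ← MemLp.toLp_add, ← MemLp.toLp_add, MemLp.toLp_eq_toLp_iff]
      refine ae_of_all _ fun x => ?_
      simp only [Pi.add_apply, Pi.sub_apply, centredWeight, Finset.sum_range_succ,
        integral_edgeWeight hα0]
      ring
  rw [h1]
  exact MemLp.coeFn_toLp _

end ONG

end

/-! ### The limit is not Gaussian -/

noncomputable section

namespace ONG

variable {d : ℕ} {α : ℝ}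

/-- Pointwise facts about the centred sums, such as lower bounds and swap identities, pass to Q
along an almost surely convergent subsequence. -/
lemma exists_seq_ae_tendsto_centredWeight (hα : 0 < α)
    {Q : (ℕ → EuclideanSpace ℝ (Fin d)) → ℝ} (hQ : Measurable Q)
    (hlim : Tendsto (fun n => eLpNorm (centredWeight α n - Q) 2 (seqLaw d)) atTop (𝓝 0)) :
    ∃ ns : ℕ → ℕ, StrictMono ns ∧
      ∀ᵐ x ∂(seqLaw d), Tendsto (fun i => centredWeight α (ns i) x) atTop (𝓝 (Q x)) :=
  (tendstoInMeasure_of_tendsto_eLpNorm two_ne_zero (fun n => (memLp_centredWeight hα n).1)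
    hQ.aestronglyMeasurable hlim).exists_seq_tendsto_ae

/-- If `α > d`, the limit is bounded below. -/
lemma exists_ae_le_of_tendsto_centredWeight (hd : 1 ≤ d) (hα : (d : ℝ) < α)
    {Q : (ℕ → EuclideanSpace ℝ (Fin d)) → ℝ} (hQ : Measurable Q)
    (hlim : Tendsto (fun n => eLpNorm (centredWeight α n - Q) 2 (seqLaw d)) atTop (𝓝 0)) :
    ∃ M : ℝ, ∀ᵐ x ∂(seqLaw d), M ≤ Q x := by
  have hdp : (0 : ℝ) < d := by exact_mod_cast hd
  have hα0 : 0 < α := hdp.trans hα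
  obtain ⟨ns, -, hns⟩ := exists_seq_ae_tendsto_centredWeight hα0 hQ hlim
  obtain ⟨C, hC, hbound⟩ := exists_integral_edgeWeight_le hd hα0
  have hnn : ∀ k, 0 ≤ ∫ y, edgeWeight α k y ∂(seqLaw d) := fun k =>
    integral_nonneg fun y => edgeWeight_nonneg α k y
  have hsum : Summable fun k => ∫ y, edgeWeight α k y ∂(seqLaw d) := by
    have h1 : 1 < α / d := (one_lt_div hdp).2 hα
    have h2 := (summable_nat_add_iff 1).2
      (Real.summable_nat_rpow.2 (by linarith : -(α / d) < -1))
    refine Summable.of_nonneg_of_le hnn hbound (Summable.mul_left C ?_)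
    simpa using h2
  refine ⟨-∑' k, ∫ y, edgeWeight α k y ∂(seqLaw d), hns.mono fun x hx => ?_⟩
  refine ge_of_tendsto' hx fun i => ?_
  rw [centredWeight, Finset.sum_sub_distrib]
  have h1 : 0 ≤ ∑ k ∈ Finset.range (ns i), edgeWeight α k x :=
    Finset.sum_nonneg fun k _ => edgeWeight_nonneg α k x
  have h2 := hsum.sum_le_tsum (Finset.range (ns i)) fun k _ => hnn k
  linarith

lemma measurePreserving_comp_perm (σ : Equiv.Perm ℕ) :
    MeasurePreserving (fun (x : ℕ → EuclideanSpace ℝ (Fin d)) i => x (σ i))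
      (seqLaw d) (seqLaw d) :=
  ⟨by fun_prop, Measure.map_infinitePi_infinitePi_of_inj σ.injective⟩

lemma minDist_comp_perm {n : ℕ} {σ : Equiv.Perm ℕ} (hσ : ∀ i, i ≤ n ↔ σ i ≤ n)
    (x : ℕ → EuclideanSpace ℝ (Fin d)) (u : EuclideanSpace ℝ (Fin d)) :
    minDist n (fun i => x (σ i)) u = minDist n x u := by
  refine le_antisymm (le_minDist_iff.2 fun i hi => ?_) (le_minDist_iff.2 fun i hi => ?_)
  · have h : σ.symm i ≤ n := by
      rw [hσ, Equiv.apply_symm_apply]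
      exact Nat.lt_succ_iff.1 (Finset.mem_range.1 hi)
    simpa using minDist_le_dist h (fun i => x (σ i)) u
  · exact minDist_le_dist ((hσ i).1 (Nat.lt_succ_iff.1 (Finset.mem_range.1 hi))) x u

lemma edgeWeight_zero (x : ℕ → EuclideanSpace ℝ (Fin d)) :
    edgeWeight α 0 x = dist (x 1) (x 0) ^ α := by
  have h : minDist 0 x (x 1) = dist (x 1) (x 0) :=
    le_antisymm (minDist_le_dist le_rfl x _) (le_minDist_iff.2 fun i hi => by
      obtain rfl : i = 0 := by simpa using hi
      exact le_rfl)
  rw [edgeWeight, zero_add, h]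

lemma edgeWeight_one (x : ℕ → EuclideanSpace ℝ (Fin d)) :
    edgeWeight α 1 x = min (dist (x 2) (x 0)) (dist (x 2) (x 1)) ^ α := by
  have h : minDist 1 x (x 2) = min (dist (x 2) (x 0)) (dist (x 2) (x 1)) :=
    le_antisymm (le_min (minDist_le_dist zero_le_one x _) (minDist_le_dist le_rfl x _))
      (le_minDist_iff.2 fun i hi => by
        have hi2 : i < 2 := Finset.mem_range.1 hi
        interval_cases i
        · exact min_le_left _ _
        · exact min_le_right _ _)
  rw [edgeWeight, one_add_one_eq_two, h]

/-- Exchanging the first and the third point affects the total weight only through the first two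
edges. -/
lemma centredWeight_swap_sub {n : ℕ} (hn : 2 ≤ n) (x : ℕ → EuclideanSpace ℝ (Fin d)) :
    centredWeight α n (fun i => x (Equiv.swap 0 2 i)) - centredWeight α n x =
      dist (x 1) (x 2) ^ α + min (dist (x 0) (x 2)) (dist (x 0) (x 1)) ^ α -
        (dist (x 1) (x 0) ^ α + min (dist (x 2) (x 0)) (dist (x 2) (x 1)) ^ α) := by
  obtain ⟨m, rfl⟩ := Nat.exists_eq_add_of_le hn
  -- From these edges on, both exchanged points are predecessors, and the nearest distance ignores
  -- their order.
  have hlarge : ∀ k, edgeWeight α (2 + k) (fun i => x (Equiv.swap 0 2 i)) =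
      edgeWeight α (2 + k) x := fun k => by
    have h1 : Equiv.swap 0 2 (2 + k + 1) = 2 + k + 1 :=
      Equiv.swap_apply_of_ne_of_ne (by omega) (by omega)
    rw [edgeWeight, edgeWeight, minDist_comp_perm, h1]
    intro i
    rw [Equiv.swap_apply_def]
    split_ifs <;> omega
  have hzero : edgeWeight α 0 (fun i => x (Equiv.swap 0 2 i)) = dist (x 1) (x 2) ^ α := by
    rw [edgeWeight_zero, Equiv.swap_apply_left,
      Equiv.swap_apply_of_ne_of_ne (by norm_num) (by norm_num)]
  have hone : edgeWeight α 1 (fun i => x (Equiv.swap 0 2 i)) =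
      min (dist (x 0) (x 2)) (dist (x 0) (x 1)) ^ α := by
    rw [edgeWeight_one, Equiv.swap_apply_left, Equiv.swap_apply_right,
      Equiv.swap_apply_of_ne_of_ne (by norm_num) (by norm_num)]
  simp only [centredWeight, Finset.sum_range_add _ 2 m, Finset.sum_range_succ,
    Finset.sum_range_zero, hlarge, hzero, hone, edgeWeight_zero, edgeWeight_one]
  ring

lemma dist_toLp_const (a b : ℝ) :
    dist (WithLp.toLp 2 fun _ => a : EuclideanSpace ℝ (Fin d)) (WithLp.toLp 2 fun _ => b) =
      √d * |a - b| := by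
  rw [EuclideanSpace.dist_eq]
  simp [Real.dist_eq, Real.sqrt_sq_eq_abs]

/-- The centres lie on the main diagonal at 2/5, 3/10 and 4/5, with distances 10r, 40r and 50r.
Moving each by less than r changes a distance by less than 2r and keeps the strict order. -/
lemma seqLaw_triangle_pos (hd : 1 ≤ d) :
    0 < seqLaw d {x | dist (x 0) (x 1) < dist (x 0) (x 2) ∧ dist (x 0) (x 2) < dist (x 1) (x 2)} := by
  have hd0 : 0 < √(d : ℝ) := Real.sqrt_pos.2 (by exact_mod_cast hd)
  set c : ℕ → ℝ := fun i => if i = 0 then 2 / 5 else if i = 1 then 3 / 10 else 4 / 5 with hc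
  set p : ℕ → EuclideanSpace ℝ (Fin d) := fun i => WithLp.toLp 2 fun _ => c i with hp
  set r : ℝ := √d / 100 with hr
  have hr0 : 0 < r := by positivity
  have hdist : ∀ i j, dist (p i) (p j) = √d * |c i - c j| := fun i j => dist_toLp_const _ _
  have h01 : dist (p 0) (p 1) = 10 * r := by
    rw [hdist, show c 0 - c 1 = 1 / 10 by norm_num [hc], abs_of_pos (by norm_num), hr]
    ring
  have h02 : dist (p 0) (p 2) = 40 * r := by
    rw [hdist, show c 0 - c 2 = -(2 / 5) by norm_num [hc], abs_neg, abs_of_pos (by norm_num), hr]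
    ring
  have h12 : dist (p 1) (p 2) = 50 * r := by
    rw [hdist, show c 1 - c 2 = -(1 / 2) by norm_num [hc], abs_neg, abs_of_pos (by norm_num), hr]
    ring
  have hsub : Set.pi (Finset.range 3 : Set ℕ) (fun i => Metric.ball (p i) r) ⊆
      {x | dist (x 0) (x 1) < dist (x 0) (x 2) ∧ dist (x 0) (x 2) < dist (x 1) (x 2)} := by
    intro x hx
    have hb : ∀ i < 3, dist (x i) (p i) < r := fun i hi => hx i (by simpa using hi)
    have hup : ∀ i < 3, ∀ j < 3, dist (x i) (x j) < dist (p i) (p j) + 2 * r := fun i hi j hj => by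
      have h1 := dist_triangle4 (x i) (p i) (p j) (x j)
      have h2 := hb i hi
      have h3 := hb j hj
      rw [dist_comm] at h3
      linarith
    have hlow : ∀ i < 3, ∀ j < 3, dist (p i) (p j) - 2 * r < dist (x i) (x j) := fun i hi j hj => by
      have h1 := dist_triangle4 (p i) (x i) (x j) (p j)
      have h2 := hb i hi
      have h3 := hb j hj
      rw [dist_comm] at h2
      linarith
    have h1 := hup 0 (by norm_num) 1 (by norm_num)
    have h2 := hlow 0 (by norm_num) 2 (by norm_num)
    have h3 := hup 0 (by norm_num) 2 (by norm_num)
    have h4 := hlow 1 (by norm_num) 2 (by norm_num)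
    rw [h01] at h1
    rw [h02] at h2 h3
    rw [h12] at h4
    exact ⟨by linarith, by linarith⟩
  refine lt_of_lt_of_le ?_ (measure_mono hsub)
  rw [seqLaw, Measure.infinitePi_pi _ fun i _ => Metric.isOpen_ball.measurableSet]
  refine pos_iff_ne_zero.2 (Finset.prod_ne_zero_iff.2 fun i _ => (cubeLaw_pos_of_isOpen
    Metric.isOpen_ball ⟨p i, Metric.mem_ball_self hr0, fun k => ?_⟩).ne')
  simp only [hp, hc, Set.mem_Ioo]
  split_ifs <;> norm_num

/-- The limit is not almost surely constant. -/
lemma not_ae_eq_const_of_tendsto_centredWeight (hd : 1 ≤ d) (hα : 0 < α)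
    {Q : (ℕ → EuclideanSpace ℝ (Fin d)) → ℝ} (hQ : Measurable Q)
    (hlim : Tendsto (fun n => eLpNorm (centredWeight α n - Q) 2 (seqLaw d)) atTop (𝓝 0)) (c : ℝ) :
    ¬ ∀ᵐ x ∂(seqLaw d), Q x = c := by
  intro hconst
  obtain ⟨ns, hmono, hns⟩ := exists_seq_ae_tendsto_centredWeight hα hQ hlim
  have hσ := (measurePreserving_comp_perm (d := d) (Equiv.swap 0 2)).quasiMeasurePreserving
  -- With Q constant, the sums at x and at the swapped x have the same limit; yet on this event they
  -- differ, from n = 2 on, by the fixed positive number d(x 1, x 2)^α − d(x 0, x 2)^α.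
  have hae : ∀ᵐ x ∂(seqLaw d),
      ¬ (dist (x 0) (x 1) < dist (x 0) (x 2) ∧ dist (x 0) (x 2) < dist (x 1) (x 2)) := by
    filter_upwards [hns, hσ.ae hns, hconst, hσ.ae hconst] with x h1 h2 h3 h4
    rintro ⟨h5, h6⟩
    have h7 := h2.sub h1
    rw [h3, h4, sub_self] at h7
    have h8 := tendsto_nhds_unique (h7.congr' ?_) tendsto_const_nhds (b := dist (x 1) (x 2) ^ α -
      dist (x 0) (x 2) ^ α)
    · have h9 := Real.rpow_lt_rpow dist_nonneg h6 hα
      linarith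
    · filter_upwards [hmono.tendsto_atTop.eventually_ge_atTop 2] with i hi
      rw [centredWeight_swap_sub hi, min_eq_right h5.le, dist_comm (x 2), dist_comm (x 2),
        min_eq_left h6.le, dist_comm (x 0) (x 1)]
      ring
  exact (seqLaw_triangle_pos hd).ne' (by simpa [ae_iff] using hae)

/-- If `α > d`, the law of the limit is not Gaussian. -/
lemma not_isGaussian_of_tendsto_centredWeight (hd : 1 ≤ d) (hα : (d : ℝ) < α)
    {Q : (ℕ → EuclideanSpace ℝ (Fin d)) → ℝ} (hQ : Measurable Q)
    (hlim : Tendsto (fun n => eLpNorm (centredWeight α n - Q) 2 (seqLaw d)) atTop (𝓝 0)) :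
    ¬ IsGaussian ((seqLaw d).map Q) := by
  intro hG
  have hα0 : 0 < α := (Nat.cast_nonneg d).trans_lt hα
  obtain ⟨M, hM⟩ := exists_ae_le_of_tendsto_centredWeight hd hα hQ hlim
  obtain ⟨m, v, hmv⟩ : ∃ m v, (seqLaw d).map Q = gaussianReal m v :=
    ⟨_, _, IsGaussian.eq_gaussianReal _ hG⟩
  -- `IsGaussian` admits point masses, so variance zero needs its own argument; with positive
  -- variance every half-line is charged.
  rcases eq_or_ne v 0 with rfl | hv
  · rw [gaussianReal_zero_var] at hmv
    refine not_ae_eq_const_of_tendsto_centredWeight hd hα0 hQ hlim m ?_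
    refine ae_of_ae_map (p := fun y => y = m) hQ.aemeasurable ?_
    rw [hmv, ae_dirac_eq]
    exact eventually_pure.2 rfl
  · have h1 : (seqLaw d).map Q (Set.Iio M) = 0 := by
      rw [Measure.map_apply hQ measurableSet_Iio]
      have h2 : ∀ᵐ x ∂(seqLaw d), x ∉ Q ⁻¹' Set.Iio M := hM.mono fun x hx => not_lt.2 hx
      exact measure_eq_zero_iff_ae_notMem.2 h2
    rw [hmv] at h1
    simpa using gaussianReal_absolutelyContinuous' m hv h1

end ONG

end

/-! ### Poisson moments and Poisson averages of null sequences -/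

noncomputable section

namespace ONG

section Poisson

open scoped Nat

lemma hasSum_poisson_mul_cast (t : ℝ≥0) :
    HasSum (fun n : ℕ => Real.exp (-t) * t ^ n / n ! * n) t := by
  rw [← hasSum_nat_add_iff' 1]
  convert! (hasSum_one_poissonMeasure t).mul_left (t : ℝ) using 1
  · ext n
    rw [Nat.factorial_succ]
    push_cast
    field_simp
    ring
  · simp

lemma hasSum_poisson_mul_sq (t : ℝ≥0) :
    HasSum (fun n : ℕ => Real.exp (-t) * t ^ n / n ! * (n : ℝ) ^ 2) (t * (t + 1)) := by
  rw [← hasSum_nat_add_iff' 1]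
  convert! ((hasSum_poisson_mul_cast t).add (hasSum_one_poissonMeasure t)).mul_left (t : ℝ) using 1
  · ext n
    rw [Nat.factorial_succ]
    push_cast
    field_simp
    ring
  · simp

lemma hasSum_poisson_mul_sub_sq (t : ℝ≥0) :
    HasSum (fun n : ℕ => Real.exp (-t) * t ^ n / n ! * ((n : ℝ) - t) ^ 2) t := by
  convert! ((hasSum_poisson_mul_sq t).sub ((hasSum_poisson_mul_cast t).mul_left (2 * (t : ℝ)))).add
    ((hasSum_one_poissonMeasure t).mul_left ((t : ℝ) ^ 2)) using 1
  · ext n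
    ring
  · ring

lemma integrable_sub_sq_poissonMeasure (t : ℝ≥0) :
    Integrable (fun n : ℕ => ((n : ℝ) - t) ^ 2) (poissonMeasure t) := by
  rw [integrable_poissonMeasure_iff]
  simpa using (hasSum_poisson_mul_sub_sq t).summable

lemma integral_sub_sq_poissonMeasure (t : ℝ≥0) :
    ∫ n : ℕ, ((n : ℝ) - t) ^ 2 ∂(poissonMeasure t) = t := by
  rw [integral_poissonMeasure]
  exact (hasSum_poisson_mul_sub_sq t).tsum_eq

lemma memLp_cast_poissonMeasure (t : ℝ≥0) :
    MemLp (fun n : ℕ => (n : ℝ)) 2 (poissonMeasure t) := by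
  rw [memLp_two_iff_integrable_sq (by fun_prop), integrable_poissonMeasure_iff]
  simpa using (hasSum_poisson_mul_sq t).summable

lemma tendsto_poissonMeasure_Iio (m : ℕ) :
    Tendsto (fun t : ℝ≥0 => poissonMeasure t (Set.Iio m)) atTop (𝓝 0) := by
  have h1 : ∀ n : ℕ, Tendsto (fun t : ℝ≥0 => poissonMeasure t {n}) atTop (𝓝 0) := fun n => by
    have h2 := ((Real.tendsto_pow_mul_exp_neg_atTop_nhds_zero n).comp
      (NNReal.tendsto_coe_atTop.2 tendsto_id)).div_const (n ! : ℝ)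
    have h3 := ENNReal.tendsto_ofReal h2
    simp only [zero_div, ENNReal.ofReal_zero] at h3
    refine h3.congr fun t => ?_
    rw [poissonMeasure_singleton]
    simp [mul_comm]
  have h4 := tendsto_finsetSum (Finset.range m) fun n _ => h1 n
  simp only [Finset.sum_const_zero] at h4
  refine h4.congr fun t => ?_
  rw [sum_measure_singleton]
  congr 1
  ext n
  simp

/-- Averaging a null sequence over a Poisson distribution with large mean. -/
lemma tendsto_lintegral_poissonMeasure {A : ℕ → ℝ≥0∞} (hA : ∀ n, A n ≠ ∞)
    (hlim : Tendsto A atTop (𝓝 0)) :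
    Tendsto (fun t : ℝ≥0 => ∫⁻ n, A n ∂(poissonMeasure t)) atTop (𝓝 0) := by
  rw [ENNReal.tendsto_nhds_zero]
  intro ε hε
  have hε2 : 0 < ε / 2 := ENNReal.half_pos hε.ne'
  obtain ⟨m, hm⟩ := eventually_atTop.1 (ENNReal.tendsto_nhds_zero.1 hlim _ hε2)
  set K : ℝ≥0∞ := ∑ n ∈ Finset.range m, A n with hK
  have hKt : K ≠ ∞ := ENNReal.sum_ne_top.2 fun n _ => hA n
  have h1 : Tendsto (fun t : ℝ≥0 => K * poissonMeasure t (Set.Iio m)) atTop (𝓝 0) := by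
    simpa using ENNReal.Tendsto.const_mul (tendsto_poissonMeasure_Iio m) (Or.inr hKt)
  filter_upwards [ENNReal.tendsto_nhds_zero.1 h1 _ hε2] with t ht
  calc ∫⁻ n, A n ∂(poissonMeasure t)
      ≤ ∫⁻ n, (ε / 2 + (Set.Iio m).indicator (fun _ => K) n) ∂(poissonMeasure t) := by
        refine lintegral_mono fun n => ?_
        rcases lt_or_ge n m with h | h
        · rw [Set.indicator_of_mem (Set.mem_Iio.2 h)]
          exact (Finset.single_le_sum (fun _ _ => bot_le) (Finset.mem_range.2 h)).trans le_add_self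
        · exact (hm n h).trans le_self_add
    _ = ε / 2 + K * poissonMeasure t (Set.Iio m) := by
        rw [lintegral_add_left measurable_const, lintegral_const, measure_univ, mul_one,
          lintegral_indicator_const measurableSet_Iio]
    _ ≤ ε / 2 + ε / 2 := by gcongr
    _ = ε := ENNReal.add_halves ε

end Poisson

/-! ### Increments of power sums -/

section PowerBounds

/-- Bernoulli's inequality for exponents in [0,1] at s = −1/(k+1). With p = 1 − γ it bounds
(k+1)^(−γ) by a telescoping difference. -/
lemma mul_rpow_le_sub_rpow {p : ℝ} (hp : 0 ≤ p) (hp1 : p ≤ 1) (k : ℕ) :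
    p * ((k : ℝ) + 1) ^ (p - 1) ≤ ((k : ℝ) + 1) ^ p - (k : ℝ) ^ p := by
  have hk : (0 : ℝ) < k + 1 := by positivity
  have h1 := rpow_one_add_le_one_add_mul_self (s := -(1 / ((k : ℝ) + 1)))
    (by rw [neg_le_neg_iff, div_le_one hk]; linarith [(Nat.cast_nonneg k : (0 : ℝ) ≤ k)]) hp hp1
  have h2 : (k : ℝ) = (k + 1) * (1 + -(1 / ((k : ℝ) + 1))) := by
    field_simp
    ring
  have h3 : (k : ℝ) ^ p = ((k : ℝ) + 1) ^ p * (1 + -(1 / ((k : ℝ) + 1))) ^ p := by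
    rw [← Real.mul_rpow hk.le, ← h2]
    have : (1 : ℝ) / (k + 1) ≤ 1 := by
      rw [div_le_one hk]
      linarith [(Nat.cast_nonneg k : (0 : ℝ) ≤ k)]
    linarith
  have h4 := mul_le_mul_of_nonneg_left h1 (Real.rpow_nonneg hk.le p)
  rw [h3, Real.rpow_sub_one hk.ne']
  refine le_trans (le_of_eq ?_) (sub_le_sub_left h4 _)
  field_simp
  ring

/-- The slope is taken at y even when x < y, where the mean value theorem would give a point below
y. This matters because x will be random and possibly 0, and y deterministic. -/
lemma abs_rpow_sub_rpow_le {p x y : ℝ} (hp1 : p ≤ 1) (hx : 0 ≤ x) (hy : 0 < y) (hp : 0 < p) :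
    |x ^ p - y ^ p| ≤ |x - y| * y ^ (p - 1) := by
  have hyp : y ^ p = y * y ^ (p - 1) := by
    rw [Real.rpow_sub_one hy.ne']
    field_simp
  rcases hx.eq_or_lt with rfl | hx0
  · rw [Real.zero_rpow hp.ne', zero_sub, zero_sub, abs_neg, abs_neg, abs_of_pos hy,
      abs_of_nonneg (Real.rpow_nonneg hy.le p), hyp]
  have hxp : x ^ p = x * x ^ (p - 1) := by
    rw [Real.rpow_sub_one hx0.ne']
    field_simp
  rcases le_total x y with h | h
  · have h1 : y ^ (p - 1) ≤ x ^ (p - 1) := Real.rpow_le_rpow_of_nonpos hx0 h (by linarith)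
    rw [abs_of_nonpos (sub_nonpos.2 (Real.rpow_le_rpow hx h hp.le)),
      abs_of_nonpos (sub_nonpos.2 h), hxp, hyp]
    nlinarith [mul_le_mul_of_nonneg_left h1 hx]
  · have h1 : x ^ (p - 1) ≤ y ^ (p - 1) := Real.rpow_le_rpow_of_nonpos hy h (by linarith)
    rw [abs_of_nonneg (sub_nonneg.2 (Real.rpow_le_rpow hy.le h hp.le)),
      abs_of_nonneg (sub_nonneg.2 h), hxp, hyp]
    nlinarith [mul_le_mul_of_nonneg_left h1 hx]

/-- Partial sums of a sequence with power decay. -/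
lemma abs_sum_range_sub_sum_range_le {b : ℕ → ℝ} {C γ : ℝ} (hb0 : ∀ k, 0 ≤ b k) (hC : 0 ≤ C)
    (hγ0 : 0 ≤ γ) (hγ1 : γ < 1) (hb : ∀ k : ℕ, b k ≤ C * ((k : ℝ) + 1) ^ (-γ)) (n : ℕ) {m : ℕ}
    (hm : 1 ≤ m) :
    |∑ k ∈ Finset.range n, b k - ∑ k ∈ Finset.range m, b k| ≤
      C / (1 - γ) * |(n : ℝ) - m| * (m : ℝ) ^ (-γ) := by
  have hp : 0 < 1 - γ := by linarith
  have hstep : ∀ k : ℕ, b k ≤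
      C / (1 - γ) * (((k + 1 : ℕ) : ℝ) ^ (1 - γ) - (k : ℝ) ^ (1 - γ)) := fun k => by
    have h1 := mul_rpow_le_sub_rpow hp.le (by linarith) k
    rw [show 1 - γ - 1 = -γ by ring] at h1
    push_cast
    calc b k ≤ C / (1 - γ) * ((1 - γ) * ((k : ℝ) + 1) ^ (-γ)) := by
          refine (hb k).trans_eq ?_
          field_simp
      _ ≤ _ := by gcongr
  have hmono : ∀ i j : ℕ, i ≤ j →
      |∑ k ∈ Finset.range j, b k - ∑ k ∈ Finset.range i, b k| ≤
        C / (1 - γ) * |(j : ℝ) ^ (1 - γ) - (i : ℝ) ^ (1 - γ)| := fun i j hij => by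
    rw [← Finset.sum_Ico_eq_sub _ hij, abs_of_nonneg (Finset.sum_nonneg fun k _ => hb0 k)]
    calc ∑ k ∈ Finset.Ico i j, b k ≤ ∑ k ∈ Finset.Ico i j,
          C / (1 - γ) * (((k + 1 : ℕ) : ℝ) ^ (1 - γ) - (k : ℝ) ^ (1 - γ)) :=
          Finset.sum_le_sum fun k _ => hstep k
      _ = C / (1 - γ) * ((j : ℝ) ^ (1 - γ) - (i : ℝ) ^ (1 - γ)) := by
          rw [← Finset.mul_sum, Finset.sum_Ico_sub (fun k : ℕ => (k : ℝ) ^ (1 - γ)) hij]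
      _ ≤ _ := by
          gcongr
          exact le_abs_self _
  have hboth : |∑ k ∈ Finset.range n, b k - ∑ k ∈ Finset.range m, b k| ≤
      C / (1 - γ) * |(n : ℝ) ^ (1 - γ) - (m : ℝ) ^ (1 - γ)| := by
    rcases le_total m n with h | h
    · exact hmono m n h
    · rw [abs_sub_comm, abs_sub_comm ((n : ℝ) ^ (1 - γ))]
      exact hmono n m h
  refine hboth.trans ?_
  rw [mul_assoc]
  gcongr
  have := abs_rpow_sub_rpow_le (p := 1 - γ) (x := n) (y := m) (by linarith) (Nat.cast_nonneg n)
    (by exact_mod_cast hm) hp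
  rwa [show 1 - γ - 1 = -γ by ring] at this

end PowerBounds

section PoissonMeans

variable {b : ℕ → ℝ} {C γ : ℝ}

lemma memLp_sum_range_poissonMeasure (hC : 0 ≤ C) (hγ : 0 ≤ γ) (hb0 : ∀ k, 0 ≤ b k)
    (hb : ∀ k : ℕ, b k ≤ C * ((k : ℝ) + 1) ^ (-γ)) (t : ℝ≥0) :
    MemLp (fun n : ℕ => ∑ k ∈ Finset.range (n - 1), b k) 2 (poissonMeasure t) := by
  refine ((memLp_cast_poissonMeasure t).const_mul C).mono (by fun_prop) (ae_of_all _ fun n => ?_)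
  rw [Real.norm_of_nonneg (Finset.sum_nonneg fun k _ => hb0 k),
    Real.norm_of_nonneg (by positivity)]
  calc ∑ k ∈ Finset.range (n - 1), b k ≤ ∑ _k ∈ Finset.range (n - 1), C := by
        refine Finset.sum_le_sum fun k _ => (hb k).trans (mul_le_of_le_one_right hC ?_)
        exact Real.rpow_le_one_of_one_le_of_nonpos (by simp) (by linarith)
    _ = (n - 1 : ℕ) * C := by simp
    _ ≤ C * n := by
        rw [mul_comm]
        gcongr
        exact Nat.sub_le n 1

/-- The partial sums of a sequence that decays faster than `k ^ (-1/2)`, stopped at a Poisson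
variable of large mean, have small variance. -/
lemma tendsto_variance_sum_range_poissonMeasure (hC : 0 ≤ C) (hγ : 1 / 2 < γ) (hγ1 : γ < 1)
    (hb0 : ∀ k, 0 ≤ b k) (hb : ∀ k : ℕ, b k ≤ C * ((k : ℝ) + 1) ^ (-γ)) :
    Tendsto (fun t : ℝ≥0 =>
      Var[fun n : ℕ => ∑ k ∈ Finset.range (n - 1), b k; poissonMeasure t]) atTop (𝓝 0) := by
  set K : ℝ := C / (1 - γ) with hK
  have hK0 : 0 ≤ K := div_nonneg hC (by linarith)
  have hbound : ∀ t : ℝ≥0, 1 ≤ t →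
      Var[fun n : ℕ => ∑ k ∈ Finset.range (n - 1), b k; poissonMeasure t] ≤
        20 * K ^ 2 * (t : ℝ) ^ (-(2 * γ - 1)) := by
    intro t ht
    have ht1 : (1 : ℝ) ≤ t := by exact_mod_cast ht
    have ht0 : (0 : ℝ) < t := by linarith
    -- The variance is at most the second moment about the sum up to m. Rounding t and the shift n −
    -- 1 cost at most 1 each, whence |n − t| + 2, and (a + 2)² ≤ 2a² + 8.
    set m : ℕ := ⌈(t : ℝ)⌉₊ with hm
    have htm : (t : ℝ) ≤ m := Nat.le_ceil _
    have hmt : (m : ℝ) < t + 1 := Nat.ceil_lt_add_one ht0.le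
    have hm1 : 1 ≤ m := by
      have : (1 : ℝ) ≤ m := ht1.trans htm
      exact_mod_cast this
    rw [← variance_sub_const (by fun_prop) (∑ k ∈ Finset.range m, b k)]
    refine (variance_le_expectation_sq (by fun_prop)).trans ?_
    have hpt : ∀ n : ℕ, (∑ k ∈ Finset.range (n - 1), b k - ∑ k ∈ Finset.range m, b k) ^ 2 ≤
        K ^ 2 * (t : ℝ) ^ (-(2 * γ)) * (2 * ((n : ℝ) - t) ^ 2 + 8) := fun n => by
      have h1 := abs_sum_range_sub_sum_range_le hb0 hC (by linarith) hγ1 hb (n - 1) hm1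
      have h2 : |((n - 1 : ℕ) : ℝ) - m| ≤ |(n : ℝ) - t| + 2 := by
        have h3 : ((n - 1 : ℕ) : ℝ) ≤ n := by exact_mod_cast Nat.sub_le n 1
        have h4 : (n : ℝ) ≤ ((n - 1 : ℕ) : ℝ) + 1 := by
          have : n ≤ n - 1 + 1 := by omega
          exact_mod_cast this
        have h5 := abs_le.1 (le_refl |(n : ℝ) - t|)
        rw [abs_le]
        constructor <;> linarith [h5.1, h5.2]
      have h3 : (m : ℝ) ^ (-γ) ≤ (t : ℝ) ^ (-γ) :=
        Real.rpow_le_rpow_of_nonpos ht0 htm (by linarith)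
      have h4 : |∑ k ∈ Finset.range (n - 1), b k - ∑ k ∈ Finset.range m, b k| ≤
          K * (|(n : ℝ) - t| + 2) * (t : ℝ) ^ (-γ) := by
        refine h1.trans ?_
        gcongr
      have h5 : ((t : ℝ) ^ (-γ)) ^ 2 = (t : ℝ) ^ (-(2 * γ)) := by
        rw [← Real.rpow_mul_natCast ht0.le]
        congr 1
        push_cast
        ring
      calc _ = |∑ k ∈ Finset.range (n - 1), b k - ∑ k ∈ Finset.range m, b k| ^ 2 := (sq_abs _).symm
        _ ≤ (K * (|(n : ℝ) - t| + 2) * (t : ℝ) ^ (-γ)) ^ 2 := by gcongr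
        _ = K ^ 2 * (t : ℝ) ^ (-(2 * γ)) * (|(n : ℝ) - t| + 2) ^ 2 := by
            rw [mul_pow, mul_pow, h5]
            ring
        _ ≤ _ := by
            gcongr
            rw [← sq_abs ((n : ℝ) - t)]
            nlinarith [sq_nonneg (|(n : ℝ) - t| - 2)]
    have h_int : Integrable (fun n : ℕ => K ^ 2 * (t : ℝ) ^ (-(2 * γ)) *
        (2 * ((n : ℝ) - t) ^ 2 + 8)) (poissonMeasure t) :=
      Integrable.const_mul (((integrable_sub_sq_poissonMeasure t).const_mul 2).add
        (integrable_const (8 : ℝ))) _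
    calc _ ≤ ∫ n : ℕ, K ^ 2 * (t : ℝ) ^ (-(2 * γ)) * (2 * ((n : ℝ) - t) ^ 2 + 8)
          ∂(poissonMeasure t) :=
          integral_mono_of_nonneg (ae_of_all _ fun n => sq_nonneg _) h_int (ae_of_all _ hpt)
      _ = K ^ 2 * (t : ℝ) ^ (-(2 * γ)) * (2 * t + 8) := by
          rw [integral_const_mul, integral_add ((integrable_sub_sq_poissonMeasure t).const_mul 2)
            (integrable_const (8 : ℝ)), integral_const_mul, integral_sub_sq_poissonMeasure]
          simp
      _ ≤ K ^ 2 * (t : ℝ) ^ (-(2 * γ)) * (20 * t) := by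
          gcongr
          linarith
      _ = _ := by
          rw [show -(2 * γ - 1) = -(2 * γ) + 1 by ring, Real.rpow_add_one ht0.ne']
          ring
  have hlim : Tendsto (fun t : ℝ≥0 => 20 * K ^ 2 * (t : ℝ) ^ (-(2 * γ - 1))) atTop (𝓝 0) := by
    have := ((tendsto_rpow_neg_atTop (by linarith : 0 < 2 * γ - 1)).comp
      (NNReal.tendsto_coe_atTop.2 tendsto_id)).const_mul (20 * K ^ 2)
    simpa using this
  refine tendsto_of_tendsto_of_tendsto_of_le_of_le' tendsto_const_nhds hlim
    (Eventually.of_forall fun t => variance_nonneg _ _) ?_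
  filter_upwards [eventually_ge_atTop 1] with t ht using hbound t ht

end PoissonMeans

end ONG

end

/-! ### From the sequence space to the given probability space -/

noncomputable section

namespace ONG

variable {d : ℕ} {α : ℝ}

lemma ae_apply_ne (hd : 1 ≤ d) {i j : ℕ} (hij : i ≠ j) :
    ∀ᵐ x ∂(seqLaw d), x i ≠ x j := by
  have hm : Measurable fun x : ℕ → EuclideanSpace ℝ (Fin d) => (x i, x j) := by fun_prop
  have hmap : (seqLaw d).map (fun x => (x i, x j)) = (cubeLaw d).prod (cubeLaw d) :=
    Measure.infinitePi_map_eval_prod hij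
  have hset : MeasurableSet {p : EuclideanSpace ℝ (Fin d) × EuclideanSpace ℝ (Fin d) |
      p.1 ≠ p.2} := (measurableSet_eq_fun measurable_fst measurable_snd).compl
  have hae : ∀ᵐ p ∂((cubeLaw d).prod (cubeLaw d)), p ∈ {p : EuclideanSpace ℝ (Fin d) ×
      EuclideanSpace ℝ (Fin d) | p.1 ≠ p.2} := by
    rw [Measure.ae_prod_mem_iff_ae_ae_mem hset]
    refine ae_of_all _ fun u => ?_
    have h0 := measure_eq_zero_iff_ae_notMem.1 (cubeLaw_singleton hd u)
    exact h0.mono fun v hv h => hv h.symm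
  rw [← hmap] at hae
  exact ae_of_ae_map hm.aemeasurable hae

/-- The mean total weight of the first `n` edges. -/
def meanWeight (d : ℕ) (α : ℝ) (n : ℕ) : ℝ :=
  ∑ k ∈ Finset.range n, ∫ y, edgeWeight α k y ∂(seqLaw d)

/-- There is one edge fewer than there are points; truncated subtraction gives the empty sum for n =
0 as well as for n = 1. -/
lemma ae_ongLength_eq (hd : 1 ≤ d) (α : ℝ) : ∀ᵐ x ∂(seqLaw d), ∀ n,
    ongLength α x n = centredWeight α (n - 1) x + meanWeight d α (n - 1) := by
  have h : ∀ᵐ x ∂(seqLaw d), ∀ i j, i ≠ j → x i ≠ x j :=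
    ae_all_iff.2 fun i => ae_all_iff.2 fun j => by
      by_cases hij : i = j
      · exact ae_of_all _ fun x hne => absurd hij hne
      · exact (ae_apply_ne hd hij).mono fun x hx _ => hx
  refine h.mono fun x hx n => ?_
  rw [centredWeight, meanWeight, ← Finset.sum_add_distrib, ongLength, Finset.sum_Ico_eq_sum_range]
  refine Finset.sum_congr rfl fun k _ => ?_
  rw [sub_add_cancel, add_comm 1 k,
    nnDist_image_Iio fun i hi => hx i (k + 1) (Nat.ne_of_lt (Nat.lt_succ_of_le hi)), edgeWeight]

lemma measurable_centredWeight (α : ℝ) (n : ℕ) :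
    Measurable (centredWeight α n : (ℕ → EuclideanSpace ℝ (Fin d)) → ℝ) :=
  Finset.measurable_fun_sum _ fun k _ => (measurable_edgeWeight α k).sub_const _

lemma integral_centredWeight (hα : 0 < α) (n : ℕ) :
    ∫ x, centredWeight α n x ∂(seqLaw d) = 0 := by
  have h_int := fun k => (memLp_edgeWeight (d := d) hα k).integrable one_le_two
  simp only [centredWeight]
  have h_int' : ∀ k, Integrable (fun x => edgeWeight α k x - ∫ y, edgeWeight α k y ∂(seqLaw d))
      (seqLaw d) := fun k => (h_int k).sub (integrable_const _)
  rw [integral_finsetSum _ fun k _ => h_int' k]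
  refine Finset.sum_eq_zero fun k _ => ?_
  rw [integral_sub (h_int k) (integrable_const _)]
  simp

/-- Identifies a centred variable from any decomposition into a mean-zero part and a constant. -/
lemma centred_ae_eq {Ω : Type*} [MeasurableSpace Ω] {P : Measure Ω} [IsProbabilityMeasure P]
    {X f : Ω → ℝ} {s : ℝ} (h : X =ᵐ[P] fun ω => f ω + s) (hf : Integrable f P)
    (h0 : ∫ ω, f ω ∂P = 0) : centred P X =ᵐ[P] f := by
  have h1 : ∫ ω, X ω ∂P = s := by
    rw [integral_congr_ae h, integral_add hf (integrable_const s), h0]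
    simp
  filter_upwards [h] with ω hω
  rw [centred, h1, hω]
  ring

lemma integral_eq_zero_of_tendsto_eLpNorm {X : Type*} [MeasurableSpace X] {μ : Measure X}
    [IsProbabilityMeasure μ] {f : ℕ → X → ℝ} {g : X → ℝ} (hf : ∀ n, MemLp (f n) 2 μ)
    (hg : MemLp g 2 μ) (hf0 : ∀ n, ∫ x, f n x ∂μ = 0)
    (h : Tendsto (fun n => eLpNorm (f n - g) 2 μ) atTop (𝓝 0)) : ∫ x, g x ∂μ = 0 := by
  have h1 : Tendsto (fun n => eLpNorm (f n - g) 1 μ) atTop (𝓝 0) :=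
    tendsto_of_tendsto_of_tendsto_of_le_of_le tendsto_const_nhds h (fun _ => bot_le) fun n =>
      eLpNorm_le_eLpNorm_of_exponent_le one_le_two ((hf n).sub hg).1
  have h2 := tendsto_integral_of_L1' g hg.1
    (Eventually.of_forall fun n => (hf n).integrable one_le_two) h1
  simp only [hf0] at h2
  exact (tendsto_nhds_unique h2 tendsto_const_nhds)

section Mixture

variable {X : Type*} [MeasurableSpace X] {μ : Measure X}

lemma eLpNorm_two_sq {f : X → ℝ} : eLpNorm f 2 μ ^ 2 = ∫⁻ x, ‖f x‖ₑ ^ 2 ∂μ := by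
  have := eLpNorm_nnreal_pow_eq_lintegral (μ := μ) (f := f) (p := 2) two_ne_zero
  simpa using this

lemma eLpNorm_two_prod_sq [SFinite μ] {ρ : Measure ℕ} [SFinite ρ] {G : ℕ → X → ℝ}
    (hG : ∀ n, Measurable (G n)) :
    eLpNorm (fun p : ℕ × X => G p.1 p.2) 2 (ρ.prod μ) ^ 2 = ∫⁻ n, eLpNorm (G n) 2 μ ^ 2 ∂ρ := by
  have hm : Measurable fun p : ℕ × X => G p.1 p.2 := measurable_from_prod_countable_right hG
  simp only [eLpNorm_two_sq]
  exact lintegral_prod _ (hm.enorm.pow_const 2).aemeasurable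

lemma tendsto_zero_of_sq_tendsto_zero {ι : Type*} {l : Filter ι} {a : ι → ℝ≥0∞}
    (h : Tendsto (fun i => a i ^ 2) l (𝓝 0)) : Tendsto a l (𝓝 0) := by
  have h1 := ((ENNReal.continuous_rpow_const (y := 1 / 2)).tendsto 0).comp h
  rw [ENNReal.zero_rpow_of_pos (by norm_num)] at h1
  refine h1.congr fun i => ?_
  rw [Function.comp_apply, ← ENNReal.rpow_natCast, ← ENNReal.rpow_mul]
  norm_num

/-- A null sequence of finite norms is bounded, and averaging over n preserves the bound. -/
lemma memLp_mixture [SFinite μ] {G : ℕ → X → ℝ} (hG : ∀ n, Measurable (G n))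
    (hG2 : ∀ n, MemLp (G n) 2 μ) (hlim : Tendsto (fun n => eLpNorm (G n) 2 μ) atTop (𝓝 0))
    (ρ : Measure ℕ) [IsProbabilityMeasure ρ] :
    MemLp (fun p : ℕ × X => G p.1 p.2) 2 (ρ.prod μ) := by
  have hm : Measurable fun p : ℕ × X => G p.1 p.2 := measurable_from_prod_countable_right hG
  refine ⟨hm.aestronglyMeasurable, ?_⟩
  obtain ⟨m, hm⟩ := eventually_atTop.1 (ENNReal.tendsto_nhds_zero.1 hlim 1 one_pos)
  set K : ℝ≥0∞ := 1 + ∑ n ∈ Finset.range m, eLpNorm (G n) 2 μ with hK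
  have hKt : K ≠ ∞ :=
    ENNReal.add_ne_top.2 ⟨ENNReal.one_ne_top, ENNReal.sum_ne_top.2 fun n _ => (hG2 n).2.ne⟩
  have hle : ∀ n, eLpNorm (G n) 2 μ ≤ K := fun n => by
    rcases lt_or_ge n m with h | h
    · exact (Finset.single_le_sum (f := fun n => eLpNorm (G n) 2 μ) (fun _ _ => bot_le)
        (Finset.mem_range.2 h)).trans le_add_self
    · exact (hm n h).trans le_self_add
  have hsq : eLpNorm (fun p : ℕ × X => G p.1 p.2) 2 (ρ.prod μ) ^ 2 ≤ K ^ 2 := by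
    rw [eLpNorm_two_prod_sq hG]
    calc _ ≤ ∫⁻ _n, K ^ 2 ∂ρ := lintegral_mono fun n => by gcongr; exact hle n
      _ = K ^ 2 := by simp
  by_contra hcon
  rw [not_lt_top_iff.1 hcon, ENNReal.top_pow two_ne_zero] at hsq
  exact ENNReal.pow_ne_top hKt (top_le_iff.1 hsq)

lemma tendsto_eLpNorm_mixture [SFinite μ] {G : ℕ → X → ℝ} (hG : ∀ n, Measurable (G n))
    (hG2 : ∀ n, MemLp (G n) 2 μ) (hlim : Tendsto (fun n => eLpNorm (G n) 2 μ) atTop (𝓝 0)) :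
    Tendsto (fun t : ℝ≥0 => eLpNorm (fun p : ℕ × X => G p.1 p.2) 2 ((poissonMeasure t).prod μ))
      atTop (𝓝 0) := by
  refine tendsto_zero_of_sq_tendsto_zero ?_
  simp only [eLpNorm_two_prod_sq hG]
  refine tendsto_lintegral_poissonMeasure (fun n => ENNReal.pow_ne_top (hG2 n).2.ne) ?_
  simpa using ENNReal.Tendsto.pow (n := 2) hlim

end Mixture

/-- The decay exponent is capped at 3/4 because the comparison of power sums divides by 1 − γ; any
cap strictly between 1/2 and 1 would do. -/
lemma exists_integral_edgeWeight_le_rpow (hd : 1 ≤ d) (hα : (d : ℝ) / 2 < α) :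
    ∃ C γ : ℝ, 0 ≤ C ∧ 1 / 2 < γ ∧ γ < 1 ∧ ∀ k : ℕ,
      ∫ x, edgeWeight α k x ∂(seqLaw d) ≤ C * ((k : ℝ) + 1) ^ (-γ) := by
  have hdp : (0 : ℝ) < d := by exact_mod_cast hd
  have hγ : 1 / 2 < α / d := by
    rw [lt_div_iff₀ hdp]
    linarith
  obtain ⟨C, hC, h⟩ := exists_integral_edgeWeight_le hd (by linarith : 0 < α)
  refine ⟨C, min (α / d) (3 / 4), hC, lt_min hγ (by norm_num),
    (min_le_right _ _).trans_lt (by norm_num), fun k => (h k).trans ?_⟩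
  gcongr
  · simp
  · exact min_le_left _ _

/-- The centred total weight at a Poisson number of points, on the product space. -/
def mixedWeight (d : ℕ) (α : ℝ) (t : ℝ≥0) (p : ℕ × (ℕ → EuclideanSpace ℝ (Fin d))) : ℝ :=
  centredWeight α (p.1 - 1) p.2 +
    (meanWeight d α (p.1 - 1) - ∫ n, meanWeight d α (n - 1) ∂(poissonMeasure t))

section MixedWeight

variable {Q : (ℕ → EuclideanSpace ℝ (Fin d)) → ℝ}

lemma memLp_centredWeight_mixture (hα : 0 < α) (hQ : Measurable Q) (hQ2 : MemLp Q 2 (seqLaw d))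
    (hlim : Tendsto (fun n => eLpNorm (centredWeight α n - Q) 2 (seqLaw d)) atTop (𝓝 0))
    (t : ℝ≥0) :
    MemLp (fun p : ℕ × (ℕ → EuclideanSpace ℝ (Fin d)) => centredWeight α (p.1 - 1) p.2) 2
      ((poissonMeasure t).prod (seqLaw d)) := by
  have h1 := memLp_mixture (μ := seqLaw d) (G := fun n => centredWeight α (n - 1) - Q)
    (fun n => (measurable_centredWeight α _).sub hQ)
    (fun n => (memLp_centredWeight hα _).sub hQ2) (hlim.comp (tendsto_sub_atTop_nat 1))
    (poissonMeasure t)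
  have h2 : MemLp (fun p : ℕ × (ℕ → EuclideanSpace ℝ (Fin d)) => Q p.2) 2
      ((poissonMeasure t).prod (seqLaw d)) := hQ2.comp_snd _
  refine (h1.add h2).ae_eq (ae_of_all _ fun p => ?_)
  simp

lemma memLp_meanWeight (hd : 1 ≤ d) (hα : (d : ℝ) / 2 < α) (t : ℝ≥0) :
    MemLp (fun n : ℕ => meanWeight d α (n - 1)) 2 (poissonMeasure t) := by
  obtain ⟨C, γ, hC, hγ, -, hb⟩ := exists_integral_edgeWeight_le_rpow hd hα
  exact memLp_sum_range_poissonMeasure hC (by linarith)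
    (fun k => integral_nonneg fun x => edgeWeight_nonneg α k x) hb t

lemma memLp_mixedWeight (hd : 1 ≤ d) (hα : (d : ℝ) / 2 < α) (hQ : Measurable Q)
    (hQ2 : MemLp Q 2 (seqLaw d))
    (hlim : Tendsto (fun n => eLpNorm (centredWeight α n - Q) 2 (seqLaw d)) atTop (𝓝 0))
    (t : ℝ≥0) : MemLp (mixedWeight d α t) 2 ((poissonMeasure t).prod (seqLaw d)) := by
  have hα0 : 0 < α := lt_of_le_of_lt (by positivity) hα
  exact (memLp_centredWeight_mixture hα0 hQ hQ2 hlim t).add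
    (((memLp_meanWeight hd hα t).sub (memLp_const _)).comp_fst _)

lemma integral_mixedWeight (hd : 1 ≤ d) (hα : (d : ℝ) / 2 < α) (hQ : Measurable Q)
    (hQ2 : MemLp Q 2 (seqLaw d))
    (hlim : Tendsto (fun n => eLpNorm (centredWeight α n - Q) 2 (seqLaw d)) atTop (𝓝 0))
    (t : ℝ≥0) : ∫ p, mixedWeight d α t p ∂((poissonMeasure t).prod (seqLaw d)) = 0 := by
  have hα0 : 0 < α := lt_of_le_of_lt (by positivity) hα
  have hM := (memLp_meanWeight hd hα t).integrable one_le_two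
  rw [integral_prod _ ((memLp_mixedWeight hd hα hQ hQ2 hlim t).integrable one_le_two)]
  have h1 : ∀ n : ℕ, ∫ x, mixedWeight d α t (n, x) ∂(seqLaw d) =
      meanWeight d α (n - 1) - ∫ n, meanWeight d α (n - 1) ∂(poissonMeasure t) := fun n => by
    simp only [mixedWeight]
    rw [integral_add ((memLp_centredWeight hα0 _).integrable one_le_two) (integrable_const _),
      integral_centredWeight hα0]
    simp
  simp only [h1]
  rw [integral_sub hM (integrable_const _)]
  simp

/-- Minkowski's inequality separates the centred sum minus Q, a Poisson average of a null sequence,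
from the fluctuation of the mean function, whose squared norm is a variance. -/
lemma tendsto_eLpNorm_mixedWeight (hd : 1 ≤ d) (hα : (d : ℝ) / 2 < α) (hQ : Measurable Q)
    (hQ2 : MemLp Q 2 (seqLaw d))
    (hlim : Tendsto (fun n => eLpNorm (centredWeight α n - Q) 2 (seqLaw d)) atTop (𝓝 0)) :
    Tendsto (fun t : ℝ≥0 => eLpNorm (fun p => mixedWeight d α t p - Q p.2) 2
      ((poissonMeasure t).prod (seqLaw d))) atTop (𝓝 0) := by
  have hα0 : 0 < α := lt_of_le_of_lt (by positivity) hα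
  obtain ⟨C, γ, hC, hγ, hγ1, hb⟩ := exists_integral_edgeWeight_le_rpow hd hα
  have hG : ∀ n, Measurable (centredWeight α (n - 1) - Q) := fun n =>
    (measurable_centredWeight α _).sub hQ
  have h1 := tendsto_eLpNorm_mixture (μ := seqLaw d) (G := fun n => centredWeight α (n - 1) - Q)
    hG (fun n => (memLp_centredWeight hα0 _).sub hQ2) (hlim.comp (tendsto_sub_atTop_nat 1))
  have hvar := ENNReal.tendsto_ofReal (tendsto_variance_sum_range_poissonMeasure hC hγ hγ1
    (fun k => integral_nonneg fun x => edgeWeight_nonneg (d := d) α k x) hb)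
  rw [ENNReal.ofReal_zero] at hvar
  have h2 : Tendsto (fun t : ℝ≥0 => eLpNorm (fun n : ℕ => meanWeight d α (n - 1) -
      ∫ n, meanWeight d α (n - 1) ∂(poissonMeasure t)) 2 (poissonMeasure t)) atTop (𝓝 0) := by
    refine tendsto_zero_of_sq_tendsto_zero (hvar.congr fun t => ?_)
    rw [eLpNorm_two_sq]
    exact ofReal_variance (memLp_meanWeight hd hα t)
  have h3 := h1.add h2
  rw [add_zero] at h3
  refine tendsto_of_tendsto_of_tendsto_of_le_of_le tendsto_const_nhds h3 (fun _ => bot_le)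
    fun t => ?_
  have hm1 : Measurable fun p : ℕ × (ℕ → EuclideanSpace ℝ (Fin d)) =>
      centredWeight α (p.1 - 1) p.2 - Q p.2 := measurable_from_prod_countable_right hG
  have hfst : eLpNorm (fun p : ℕ × (ℕ → EuclideanSpace ℝ (Fin d)) => meanWeight d α (p.1 - 1) -
      ∫ n, meanWeight d α (n - 1) ∂(poissonMeasure t)) 2 ((poissonMeasure t).prod (seqLaw d)) =
      eLpNorm (fun n : ℕ => meanWeight d α (n - 1) -
        ∫ n, meanWeight d α (n - 1) ∂(poissonMeasure t)) 2 (poissonMeasure t) :=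
    eLpNorm_comp_measurePreserving (g := fun n : ℕ => meanWeight d α (n - 1) -
      ∫ n, meanWeight d α (n - 1) ∂(poissonMeasure t)) (by fun_prop) measurePreserving_fst
  simp only
  rw [← hfst]
  refine le_trans (le_of_eq ?_) (eLpNorm_add_le hm1.aestronglyMeasurable
    (Measurable.aestronglyMeasurable (by fun_prop)) one_le_two)
  congr 1
  ext p
  simp only [mixedWeight, Pi.add_apply, Pi.sub_apply]
  ring

end MixedWeight

section Transfer

variable {Ω : Type*} [MeasurableSpace Ω] {P : Measure Ω}
  {U : ℕ → Ω → EuclideanSpace ℝ (Fin d)} {Q : (ℕ → EuclideanSpace ℝ (Fin d)) → ℝ}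

lemma IsIIDUniform.measurePreserving (hU : IsIIDUniform P U) :
    MeasurePreserving (fun ω i => U i ω) P (seqLaw d) := by
  refine ⟨measurable_pi_iff.2 hU.measurable, ?_⟩
  rw [hU.indep.map_fun_eq_infinitePi_map hU.measurable, seqLaw]
  congr 1
  ext1 i
  exact hU.uniform i

lemma IsUnitPoissonProcess.map_eq {N : ℝ≥0 → Ω → ℕ} (hN : IsUnitPoissonProcess P N) (t : ℝ≥0) :
    P.map (N t) = poissonMeasure t := by
  have h := hN.poissonIncr 0 t bot_le
  rw [tsub_zero] at h
  rw [← h]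
  refine Measure.map_congr (hN.zero.mono fun ω hω => ?_)
  simp [hω]

/-- The model space may vary with i: in the Poisson case its law changes with t, while R stays one
fixed variable. -/
lemma tendstoInL2_of_ae_eq_comp {ι : Type*} {l : Filter ι} {Y : ι → Type*}
    [∀ i, MeasurableSpace (Y i)] {ρ : ∀ i, Measure (Y i)} {T : ∀ i, Ω → Y i}
    (hT : ∀ i, MeasurePreserving (T i) P (ρ i)) {Z : ι → Ω → ℝ} {R : Ω → ℝ}
    {f g : ∀ i, Y i → ℝ} (hZ : ∀ i, Z i =ᵐ[P] f i ∘ T i) (hR : ∀ i, R = g i ∘ T i)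
    (hR2 : MemLp R 2 P) (hf : ∀ i, MemLp (f i) 2 (ρ i)) (hg : ∀ i, MemLp (g i) 2 (ρ i))
    (hlim : Tendsto (fun i => eLpNorm (f i - g i) 2 (ρ i)) l (𝓝 0)) :
    TendstoInL2 P Z l R := by
  refine ⟨fun i => ((hf i).comp_measurePreserving (hT i)).ae_eq (hZ i).symm, hR2, ?_⟩
  refine hlim.congr fun i => ?_
  rw [← eLpNorm_comp_measurePreserving ((hf i).sub (hg i)).1 (hT i)]
  refine eLpNorm_congr_ae ?_
  filter_upwards [hZ i] with ω hω
  rw [Pi.sub_apply, hω, hR i]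
  rfl

lemma tendstoInL2_centred_ongLength [IsProbabilityMeasure P] (hd : 1 ≤ d) (hα : 0 < α) (hU : IsIIDUniform P U)
    (hQ2 : MemLp Q 2 (seqLaw d))
    (hlim : Tendsto (fun n => eLpNorm (centredWeight α n - Q) 2 (seqLaw d)) atTop (𝓝 0)) :
    TendstoInL2 P (fun n : ℕ => centred P (fun ω => ongLength α (fun i => U i ω) n)) atTop
      (fun ω => Q (fun i => U i ω)) := by
  have hmp := hU.measurePreserving
  have hlen := hmp.quasiMeasurePreserving.ae (ae_ongLength_eq hd α)
  refine tendstoInL2_of_ae_eq_comp (fun _ : ℕ => hmp) (f := fun n => centredWeight α (n - 1))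
    (g := fun _ => Q) (fun n => ?_) (fun _ => rfl) (hQ2.comp_measurePreserving hmp)
    (fun n => memLp_centredWeight hα _) (fun _ => hQ2) (hlim.comp (tendsto_sub_atTop_nat 1))
  have h2 := memLp_centredWeight (d := d) hα (n - 1)
  refine centred_ae_eq (s := meanWeight d α (n - 1)) (hlen.mono fun ω hω => hω n)
    ((h2.comp_measurePreserving hmp).integrable one_le_two) ?_
  have := integral_map hmp.measurable.aemeasurable (by rw [hmp.map_eq]; exact h2.1)
  rw [hmp.map_eq, integral_centredWeight hα] at this
  exact this.symm

lemma tendstoInL2_centred_ongLength_poisson [IsProbabilityMeasure P] (hd : 1 ≤ d)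
    (hα : (d : ℝ) / 2 < α) (hU : IsIIDUniform P U) {N : ℝ≥0 → Ω → ℕ} (hN : IsUnitPoissonProcess P N)
    (hind : IndepFun (fun ω t => N t ω) (fun ω i => U i ω) P) (hQ : Measurable Q)
    (hQ2 : MemLp Q 2 (seqLaw d))
    (hlim : Tendsto (fun n => eLpNorm (centredWeight α n - Q) 2 (seqLaw d)) atTop (𝓝 0)) :
    TendstoInL2 P (fun t : ℝ≥0 => centred P (fun ω => ongLength α (fun i => U i ω) (N t ω))) atTop
      (fun ω => Q (fun i => U i ω)) := by
  have hmp := hU.measurePreserving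
  have hlen := hmp.quasiMeasurePreserving.ae (ae_ongLength_eq hd α)
  -- Only the joint law of N t and the points at one fixed time matters; by independence it is a
  -- product.
  have hpair : ∀ t, MeasurePreserving (fun ω => (N t ω, fun i => U i ω)) P
      ((poissonMeasure t).prod (seqLaw d)) := fun t => by
    refine ⟨(hN.measurable t).prodMk hmp.measurable, ?_⟩
    have h1 : IndepFun (N t) (fun ω i => U i ω) P :=
      hind.comp (φ := fun f : ℝ≥0 → ℕ => f t) (measurable_pi_apply t) measurable_id
    rw [(indepFun_iff_map_prod_eq_prod_map_map (hN.measurable t).aemeasurable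
      hmp.measurable.aemeasurable).1 h1, hN.map_eq, hmp.map_eq]
  have hmix := memLp_mixedWeight hd hα hQ hQ2 hlim
  refine tendstoInL2_of_ae_eq_comp hpair (f := mixedWeight d α) (g := fun _ p => Q p.2)
    (fun t => ?_) (fun _ => rfl) (hQ2.comp_measurePreserving hmp) hmix
    (fun t => hQ2.comp_snd _) (tendsto_eLpNorm_mixedWeight hd hα hQ hQ2 hlim)
  refine centred_ae_eq (s := ∫ n, meanWeight d α (n - 1) ∂(poissonMeasure t))
    (hlen.mono fun ω hω => ?_) (((hmix t).comp_measurePreserving (hpair t)).integrable one_le_two) ?_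
  · simp only
    rw [hω (N t ω)]
    simp only [Function.comp_apply, mixedWeight]
    ring
  · have := integral_map (hpair t).measurable.aemeasurable
      (by rw [(hpair t).map_eq]; exact (hmix t).1)
    rw [(hpair t).map_eq, integral_mixedWeight hd hα hQ hQ2 hlim] at this
    exact this.symm

end Transfer

end ONG

end

theorem theorem2p2 (d : ℕ) (hd : 1 ≤ d) (α : ℝ) (hα : (d : ℝ) / 2 < α) :
    -- `ν` is the law of `Q(d,α)`; it depends on `d` and `α` only
    ∃ ν : Measure ℝ, ((d : ℝ) < α → ¬ IsGaussian ν) ∧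
      ∀ (Ω : Type*) [MeasurableSpace Ω] (P : Measure Ω) [IsProbabilityMeasure P]
        (U : ℕ → Ω → EuclideanSpace ℝ (Fin d)), ONG.IsIIDUniform P U →
        ∃ Q : Ω → ℝ, Measurable Q ∧ P.map Q = ν ∧ Integrable Q P ∧ ∫ ω, Q ω ∂P = 0 ∧
          ONG.TendstoInL2 P
            (fun n : ℕ => ONG.centred P (fun ω => ONG.ongLength α (fun i => U i ω) n))
            atTop Q ∧
          ∀ N : ℝ≥0 → Ω → ℕ, ONG.IsUnitPoissonProcess P N →
            IndepFun (fun ω t => N t ω) (fun ω i => U i ω) P →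
            ONG.TendstoInL2 P
              (fun t : ℝ≥0 => ONG.centred P (fun ω => ONG.ongLength α (fun i => U i ω) (N t ω)))
              atTop Q := by

  have hα0 : 0 < α := lt_of_le_of_lt (by positivity) hα
  obtain ⟨Q, hQ, hQ2, hlim⟩ := ONG.exists_tendsto_centredWeight hd hα
  have hQ0 := ONG.integral_eq_zero_of_tendsto_eLpNorm (fun n => ONG.memLp_centredWeight hα0 n) hQ2
    (ONG.integral_centredWeight hα0) hlim
  -- The law is fixed on the sequence space before any Ω is given; on each Ω the variable is Q
  -- evaluated at the given points.
  refine ⟨(ONG.seqLaw d).map Q,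
    fun h => ONG.not_isGaussian_of_tendsto_centredWeight hd h hQ hlim, fun Ω _ P _ U hU => ?_⟩
  have hmp := hU.measurePreserving
  refine ⟨fun ω => Q fun i => U i ω, hQ.comp hmp.measurable, ?_,
    (hQ2.comp_measurePreserving hmp).integrable one_le_two, ?_,
    ONG.tendstoInL2_centred_ongLength hd hα0 hU hQ2 hlim, fun N hN hind =>
      ONG.tendstoInL2_centred_ongLength_poisson hd hα hU hN hind hQ hQ2 hlim⟩
  · rw [← hmp.map_eq, Measure.map_map hQ hmp.measurable]
    rfl
  · have := integral_map hmp.measurable.aemeasurable (by rw [hmp.map_eq]; exact hQ2.1)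
    rw [hmp.map_eq, hQ0] at this
    exact this.symm
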